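/- Let $\mathbf{T}=\mathbf{R}/\mathbf{Z}$, with its Haar probability measure $dx$, and for a function $u:\mathbf{T}\times\mathbf{R}\to\mathbf{C}$ let $$\hat u(\xi,\tau)=\int_{\mathbf{R}}\int_{\mathbf{T}} e^{-2\pi i(x\xi+t\tau)}\,u(x,t)\,dx\,dt,\qquad (\xi,\tau)\in\mathbf{Z}\times\mathbf{R},$$ denote its space-time Fourier transform, understood in the sense of tempered distributions. Write $\langle a\rangle=(1+|a|^2)^{1/2}$ and set $$\|u\|_{X^{0,1/3}_{\tau=\xi^3}(\mathbf{T}\times\mathbf{R})}=\Big(\sum_{\xi\in\mathbf{Z}}\int_{\mathbf{R}}\langle\tau-\xi^3\rangle^{2/3}\,|\hat u(\xi,\tau)|^2\,d\tau\Big)^{1/2}\in[0,\infty],$$ which is taken to be $+\infty$ if $u$ has no tempered Fourier transform, or if $\hat u$ is not a function. Then there is an absolute constant $C<\infty$ such that, for every function $u:\mathbf{T}\times\mathbf{R}\to\mathbf{C}$, $$\|u\|_{L^4(\mathbf{T}\times\mathbf{R})}\le C\,\|u\|_{X^{0,1/3}_{\tau=\xi^3}(\mathbf{T}\times\mathbf{R})}.$$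 -/

import Mathlib

open MeasureTheory FourierTransform
open scoped NNReal ENNReal SchwartzMap

noncomputable section

/-- The bracket `⟨x⟩ = (1 + |x|²)^{1/2}`. -/
def bracket (x : ℝ) : ℝ := (1 + |x| ^ 2) ^ (1 / 2 : ℝ)

/-- The measure on the frequency space `ℤ × ℝ`, the dual group of `𝕋 × ℝ`:
counting measure times Lebesgue measure. -/
def freqMeasure : Measure (ℤ × ℝ) := (Measure.count : Measure ℤ).prod (volume : Measure ℝ)

/-- `g` is the space-time Fourier transform of the function `u` on `𝕋 × ℝ`, `𝕋 = ℝ/ℤ`,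
`g (ξ, τ) = ∫∫ exp (-2πi (x ξ + t τ)) u (x, t) dx dt`, in the sense of tempered distributions in
the time variable: `u` and `g` are integrable against Schwartz functions of `t` and `τ`, and
`∫∫ u (x, t) exp (-2πi ξ x) φ̂ (t) dx dt = ∫ g (ξ, τ) φ (τ) dτ`
for all `ξ ∈ ℤ` and all Schwartz functions `φ`. Such a `g` is unique almost everywhere. -/
structure IsFourierTransform (u : UnitAddCircle × ℝ → ℂ) (g : ℤ × ℝ → ℂ) : Prop where
  aestronglyMeasurable : AEStronglyMeasurable g freqMeasure
  integrable_left : ∀ φ : 𝓢(ℝ, ℂ), Integrable (fun p : UnitAddCircle × ℝ => u p * φ p.2)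
  integrable_right : ∀ (ξ : ℤ) (φ : 𝓢(ℝ, ℂ)), Integrable (fun τ : ℝ => g (ξ, τ) * φ τ)
  integral_eq : ∀ (ξ : ℤ) (φ : 𝓢(ℝ, ℂ)),
    ∫ p : UnitAddCircle × ℝ, u p * (fourier (-ξ) p.1 * (𝓕 φ) p.2) = ∫ τ : ℝ, g (ξ, τ) * φ τ

/-- The norm `‖⟨ξ⟩^s ⟨τ - h(ξ)⟩^b û(ξ, τ)‖_{L²(ℤ × ℝ)}` of the space `X^{s,b}_{τ = h(ξ)}(𝕋 × ℝ)`,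
with values in `[0, ∞]`. It is `∞` when `u` has no Fourier transform that is a function. (The
infimum merely selects the almost everywhere unique Fourier transform of `u`.) -/
def xsbNorm (s b : ℝ) (h : ℤ → ℝ) (u : UnitAddCircle × ℝ → ℂ) : ℝ≥0∞ :=
  ⨅ (g : ℤ × ℝ → ℂ) (_ : IsFourierTransform u g),
    eLpNorm (fun q : ℤ × ℝ =>
      ((bracket (q.1 : ℝ) ^ s * bracket (q.2 - h q.1) ^ b : ℝ) : ℂ) * g q) 2 freqMeasure

end

/-! ### Squares of integrals -/

/-! The fourth power of the `L⁴` norm of `u` is the square of the `L²` norm of `u²`, so by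
Plancherel everything reduces to an `L²` bound for the self-convolution of `F = |û|` on `ℤ × ℝ`.
Sort frequencies by modulation: at level `j` the weight `⟨τ - ξ³⟩` is about `64 ^ j`, so its cube
root is about `4 ^ j`, and `G = 4 ^ level * F` is controlled in `L²`. By symmetry only pairs of
levels `i ≤ j` matter.

If the output frequency satisfies `|ξ| < 4 ^ (j + 1)`, the number of possible `ξ` is `O(4 ^ j)` and
Cauchy–Schwarz suffices (`lintegral_low_sq_le`). If `|ξ| ≥ 4 ^ (j + 1)`, the identity `n³ + (ξ-n)³ -
m³ - (ξ-m)³ = 3ξ(n-m)(n+m-ξ)` leaves only `O(4 ^ j)` input frequencies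
(`exists_finset_of_cubic_resonance`). Each pair of levels is then bounded with a gain `2 ^
(2(i-j))`. This does not sum over the diagonal `i = j` by itself, so Cauchy–Schwarz is weighted by
the masses of `G` near each level, giving almost orthogonality (`lintegral_high_sq_le`). The two
cases combine in `lintegral_conv_sq_le`.

This proves the estimate for finite sums of characters with Schwartz coefficients
(`eLpNorm_fourierSum_le`). For a general transform `g` of finite norm, density and completeness of
`L⁴` produce some `U` with transform `g` obeying the bound (`exists_isFourierTransform`). Since `u`
is not known in advance to lie in `L⁴`, a uniqueness theorem (`IsFourierTransform.ae_eq`) is needed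
to identify it with `U`. -/

theorem ENNReal.le_add_of_sq_le_mul {z a b : ℝ≥0∞} (h : z ^ 2 ≤ a * b) : z ≤ a + b := by
  rw [← ENNReal.pow_le_pow_left_iff two_ne_zero]
  refine h.trans ?_
  rw [sq]
  gcongr
  · exact le_self_add
  · exact le_add_self

theorem ENNReal.add_sq_le (a b : ℝ≥0∞) : (a + b) ^ 2 ≤ 3 * (a ^ 2 + b ^ 2) := by
  have h : a * b ≤ a ^ 2 + b ^ 2 := ENNReal.le_add_of_sq_le_mul (by rw [mul_pow])
  calc (a + b) ^ 2 = a ^ 2 + b ^ 2 + 2 * (a * b) := by ring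
    _ ≤ a ^ 2 + b ^ 2 + 2 * (a ^ 2 + b ^ 2) := by gcongr
    _ = _ := by ring

/-- Cauchy–Schwarz up to a factor 2, proved by doubling the variable: `Z q * Z q'` squares to at
most `(X q * Y q') * (X q' * Y q)`. No square roots or finiteness conditions enter. -/
theorem lintegral_sq_le_two_mul {α : Type*} [MeasurableSpace α] {μ : Measure α}
    {X Y Z : α → ℝ≥0∞} (hX : Measurable X) (hY : Measurable Y) (hZ : Measurable Z)
    (h : ∀ q, Z q ^ 2 ≤ X q * Y q) :
    (∫⁻ q, Z q ∂μ) ^ 2 ≤ 2 * ((∫⁻ q, X q ∂μ) * ∫⁻ q, Y q ∂μ) := by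
  have key : ∀ q q', Z q * Z q' ≤ X q * Y q' + X q' * Y q := fun q q' => by
    apply ENNReal.le_add_of_sq_le_mul
    calc (Z q * Z q') ^ 2 = Z q ^ 2 * Z q' ^ 2 := by ring
      _ ≤ (X q * Y q) * (X q' * Y q') := by gcongr <;> exact h _
      _ = _ := by ring
  calc (∫⁻ q, Z q ∂μ) ^ 2 = ∫⁻ q, ∫⁻ q', Z q * Z q' ∂μ ∂μ := by
        simp_rw [lintegral_const_mul _ hZ, lintegral_mul_const _ hZ, sq]
    _ ≤ ∫⁻ q, ∫⁻ q', (X q * Y q' + X q' * Y q) ∂μ ∂μ := by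
        gcongr with q q'; exact key q q'
    _ = _ := by
        have : ∀ q, ∫⁻ q', (X q * Y q' + X q' * Y q) ∂μ
            = X q * (∫⁻ q', Y q' ∂μ) + (∫⁻ q', X q' ∂μ) * Y q := fun q => by
          rw [lintegral_add_left (hY.const_mul _), lintegral_const_mul _ hY,
            lintegral_mul_const _ hX]
        simp_rw [this]
        rw [lintegral_add_left (hX.mul_const _), lintegral_const_mul _ hY,
            lintegral_mul_const _ hX]
        ring

/-! ### The frequency measure -/

instance : SFinite freqMeasure := by unfold freqMeasure; infer_instance

instance : freqMeasure.IsAddLeftInvariant := by unfold freqMeasure; infer_instance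

instance : freqMeasure.IsNegInvariant := by
  constructor
  have h := Measure.map_prod_map (Measure.count : Measure ℤ) (volume : Measure ℝ)
    (measurable_neg) (measurable_neg)
  change Measure.map (Prod.map Neg.neg Neg.neg) freqMeasure = freqMeasure
  rw [freqMeasure, ← h]
  congr 1
  · exact Measure.neg_eq_self _
  · exact Measure.neg_eq_self _

theorem lintegral_freqMeasure {f : ℤ × ℝ → ℝ≥0∞} (hf : Measurable f) :
    ∫⁻ q, f q ∂freqMeasure = ∑' n : ℤ, ∫⁻ τ : ℝ, f (n, τ) := by
  rw [freqMeasure, lintegral_prod _ hf.aemeasurable, lintegral_count]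

/-! ### Modulation levels -/

theorem one_le_bracket (x : ℝ) : 1 ≤ bracket x :=
  Real.one_le_rpow (by nlinarith [sq_nonneg |x|]) (by norm_num)

theorem bracket_pos (x : ℝ) : 0 < bracket x := one_pos.trans_le (one_le_bracket x)

theorem abs_le_bracket (x : ℝ) : |x| ≤ bracket x := by
  unfold bracket
  rw [← Real.sqrt_eq_rpow]
  exact Real.le_sqrt_of_sq_le (by linarith)

theorem continuous_bracket : Continuous bracket := by
  unfold bracket
  exact (by fun_prop : Continuous fun x : ℝ => 1 + |x| ^ 2).rpow_const fun x => Or.inr (by norm_num)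

/-- The integer part of the logarithm to base `64` of the modulation weight `⟨τ - ξ³⟩`. -/
noncomputable def modLevel (q : ℤ × ℝ) : ℕ := Nat.log 64 ⌊bracket (q.2 - (q.1 : ℝ) ^ 3)⌋₊

@[fun_prop]
theorem measurable_modLevel : Measurable modLevel := by
  refine (Measurable.of_discrete (f := Nat.log 64)).comp (Nat.measurable_floor.comp
    (continuous_bracket.measurable.comp (measurable_snd.sub ?_)))
  exact (Measurable.of_discrete (f := fun n : ℤ => (n : ℝ) ^ 3)).comp measurable_fst

theorem pow_modLevel_le (q : ℤ × ℝ) : (64 : ℝ) ^ modLevel q ≤ bracket (q.2 - (q.1 : ℝ) ^ 3) := by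
  have h1 := one_le_bracket (q.2 - (q.1 : ℝ) ^ 3)
  have h := Nat.pow_log_le_self 64 (Nat.floor_pos.2 h1).ne'
  calc (64 : ℝ) ^ modLevel q = ((64 ^ modLevel q : ℕ) : ℝ) := by push_cast; rfl
    _ ≤ (⌊bracket (q.2 - (q.1 : ℝ) ^ 3)⌋₊ : ℝ) := by exact Nat.cast_le.2 h
    _ ≤ _ := Nat.floor_le (by linarith)

theorem abs_lt_pow_modLevel (q : ℤ × ℝ) : |q.2 - (q.1 : ℝ) ^ 3| < (64 : ℝ) ^ (modLevel q + 1) := by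
  have h := Nat.lt_pow_succ_log_self (b := 64) (by norm_num) ⌊bracket (q.2 - (q.1 : ℝ) ^ 3)⌋₊
  rw [Nat.floor_lt (bracket_pos _).le] at h
  calc _ ≤ _ := abs_le_bracket _
    _ < _ := h
    _ = _ := by push_cast; rfl

-- From here on only measurability and the two-sided comparison with powers of 64 are used.
attribute [irreducible] modLevel

theorem volume_modLevel_eq_le (n : ℤ) (j : ℕ) :
    volume {τ : ℝ | modLevel (n, τ) = j} ≤ 2 * 64 ^ (j + 1) := by
  calc volume {τ : ℝ | modLevel (n, τ) = j}
      ≤ volume (Metric.ball ((n : ℝ) ^ 3) (64 ^ (j + 1))) := by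
        refine measure_mono fun τ hτ => ?_
        rw [Metric.mem_ball, Real.dist_eq, ← (show modLevel (n, τ) = j from hτ)]
        exact abs_lt_pow_modLevel (n, τ)
    _ = _ := by
        rw [Real.volume_ball, ENNReal.ofReal_mul two_pos.le, ENNReal.ofReal_pow (by norm_num)]
        norm_num

/-- Level `j` occupies length `O(2 ^ (6 * j))`, so the weight leaves `2 ^ j`, and the geometric sum
is dominated by its top term. The exponent 4 below loses a further `2 ^ K`. -/
theorem lintegral_modLevel_five_le (n : ℤ) (K : ℕ) :
    ∫⁻ τ : ℝ, (if modLevel (n, τ) ≤ K then (2⁻¹ : ℝ≥0∞) ^ (5 * modLevel (n, τ)) else 0)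
      ≤ 256 * 2 ^ K := by
  have hm : Measurable fun τ : ℝ => modLevel (n, τ) := measurable_modLevel.comp (by fun_prop)
  have hs : ∀ j, MeasurableSet {τ : ℝ | modLevel (n, τ) = j} := fun j =>
    hm (measurableSet_singleton j)
  calc _ ≤ ∫⁻ τ : ℝ, ∑ j ∈ Finset.range (K + 1),
        Set.indicator {τ : ℝ | modLevel (n, τ) = j} (fun _ => (2⁻¹ : ℝ≥0∞) ^ (5 * j)) τ := by
        refine lintegral_mono fun τ => ?_
        dsimp only
        split_ifs with h
        · refine le_trans (le_of_eq ?_) (Finset.single_le_sum (fun _ _ => zero_le)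
            (Finset.mem_range.2 (Nat.lt_succ_of_le h)))
          simp
        · exact zero_le
    _ = ∑ j ∈ Finset.range (K + 1), (2⁻¹ : ℝ≥0∞) ^ (5 * j) * volume {τ : ℝ | modLevel (n, τ) = j} := by
        rw [lintegral_finsetSum _ fun j _ => measurable_const.indicator (hs j)]
        refine Finset.sum_congr rfl fun j _ => ?_
        rw [lintegral_indicator_const (hs j)]
    _ ≤ ∑ j ∈ Finset.range (K + 1), 128 * (2 : ℝ≥0∞) ^ j := by
        refine Finset.sum_le_sum fun j _ => ?_
        calc _ ≤ (2⁻¹ : ℝ≥0∞) ^ (5 * j) * (2 * 64 ^ (j + 1)) := by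
              gcongr; exact volume_modLevel_eq_le n j
          _ = 128 * 2 ^ j * ((2⁻¹ : ℝ≥0∞) ^ (5 * j) * 2 ^ (5 * j)) := by
              rw [show (64 : ℝ≥0∞) = 2 ^ 6 by norm_num, ← pow_mul]
              ring
          _ = _ := by
              rw [← mul_pow, ENNReal.inv_mul_cancel (by norm_num) (by norm_num), one_pow, mul_one]
    _ ≤ _ := by
        have : ∀ K : ℕ, ∑ j ∈ Finset.range (K + 1), 128 * (2 : ℝ≥0∞) ^ j ≤ 256 * 2 ^ K := by
          intro K
          induction K with
          | zero => norm_num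
          | succ K ih =>
            rw [Finset.sum_range_succ]
            calc _ ≤ 256 * 2 ^ K + 128 * (2 : ℝ≥0∞) ^ (K + 1) := by gcongr
              _ = 256 * 2 ^ (K + 1) := by ring
        exact this K

theorem lintegral_modLevel_four_le (n : ℤ) (K : ℕ) :
    ∫⁻ τ : ℝ, (if modLevel (n, τ) ≤ K then (2⁻¹ : ℝ≥0∞) ^ (4 * modLevel (n, τ)) else 0)
      ≤ 256 * 4 ^ K := by
  calc _ ≤ ∫⁻ τ : ℝ, 2 ^ K *
        (if modLevel (n, τ) ≤ K then (2⁻¹ : ℝ≥0∞) ^ (5 * modLevel (n, τ)) else 0) := by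
        refine lintegral_mono fun τ => ?_
        dsimp only
        split_ifs with h
        · calc (2⁻¹ : ℝ≥0∞) ^ (4 * modLevel (n, τ))
              = (2⁻¹ : ℝ≥0∞) ^ (4 * modLevel (n, τ)) * (2⁻¹ * 2) ^ modLevel (n, τ) := by
                rw [ENNReal.inv_mul_cancel (by norm_num) (by norm_num), one_pow, mul_one]
            _ = 2 ^ modLevel (n, τ) * (2⁻¹ : ℝ≥0∞) ^ (5 * modLevel (n, τ)) := by ring
            _ ≤ _ := by gcongr; norm_num
        · exact zero_le
    _ = 2 ^ K * _ := lintegral_const_mul' _ _ (by finiteness)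
    _ ≤ 2 ^ K * (256 * 2 ^ K) := by gcongr; exact lintegral_modLevel_five_le n K
    _ = _ := by rw [show (4 : ℝ≥0∞) = 2 * 2 by norm_num, mul_pow]; ring

/-! ### Counting -/

theorem ENNReal.tsum_le_card_mul {ι : Type*} {f : ι → ℝ≥0∞} {c : ℝ≥0∞} (T : Finset ι)
    (h : ∀ i ∈ T, f i ≤ c) (h0 : ∀ i ∉ T, f i = 0) : ∑' i, f i ≤ T.card * c := by
  rw [tsum_eq_sum h0, ← nsmul_eq_mul]
  exact Finset.sum_le_card_nsmul _ _ _ h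

/-- The number of `n` with `n³ + (ξ - n)³` in an interval of length `∼ 64 ^ k` is `O(4 ^ k)`
when `|ξ| ≥ 4 ^ (k + 1)`. -/
theorem exists_finset_of_cubic_resonance (ξ : ℤ) (τ : ℝ) (k : ℕ) (hξ : 4 ^ (k + 1) ≤ |ξ|) :
    ∃ T : Finset ℤ, T.card ≤ 34 * 4 ^ k ∧
      ∀ n : ℤ, |τ - (n : ℝ) ^ 3 - ((ξ : ℝ) - n) ^ 3| < 2 * 64 ^ (k + 1) → n ∈ T := by
  -- If there is a solution `m`, every other solution is compared with it.
  by_cases hne : ∃ m : ℤ, |τ - (m : ℝ) ^ 3 - ((ξ : ℝ) - m) ^ 3| < 2 * 64 ^ (k + 1)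
  swap
  · push Not at hne
    exact ⟨∅, by simp, fun n hn => absurd hn (hne n).not_gt⟩
  obtain ⟨m, hm⟩ := hne
  set P : ℤ := 4 ^ (k + 1) with hP
  have hP0 : 0 < P := by positivity
  -- Windows about the two roots `m` and `ξ - m` of the resonance function. They hold at most `2 *
  -- (4 * P + 1) = 32 * 4 ^ k + 2` integers; outside both, the product would exceed `3 * P * (2 * P)
  -- ^ 2 = 12 * P ^ 3`.
  refine ⟨Finset.Icc (m - 2 * P) (m + 2 * P) ∪ Finset.Icc (ξ - m - 2 * P) (ξ - m + 2 * P),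
    ?_, fun n hn => ?_⟩
  · refine (Finset.card_union_le _ _).trans ?_
    rw [Int.card_Icc, Int.card_Icc]
    have h1 : (1 : ℤ) ≤ 4 ^ k := one_le_pow₀ (by norm_num)
    have h2 : P = 4 * 4 ^ k := by rw [hP]; ring
    zify
    rw [Int.toNat_of_nonneg (by linarith), Int.toNat_of_nonneg (by linarith)]
    linarith
  · have hlt : |3 * ξ * (n - m) * (n + m - ξ)| < 4 * P ^ 3 := by
      have : |((3 * ξ * (n - m) * (n + m - ξ) : ℤ) : ℝ)| < 4 * (P : ℝ) ^ 3 := by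
        have e : ((3 * ξ * (n - m) * (n + m - ξ) : ℤ) : ℝ)
          = (τ - (m : ℝ) ^ 3 - ((ξ : ℝ) - m) ^ 3) - (τ - (n : ℝ) ^ 3 - ((ξ : ℝ) - n) ^ 3) := by
          push_cast; ring
        have e2 : (P : ℝ) ^ 3 = 64 ^ (k + 1) := by
          rw [hP]; push_cast; rw [← pow_mul, mul_comm, pow_mul]; norm_num
        rw [e, e2]
        refine (abs_sub _ _).trans_lt ?_
        linarith
      exact_mod_cast this
    by_contra hnot
    simp only [Finset.mem_union, Finset.mem_Icc, not_or] at hnot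
    have h1 : 2 * P < |n - m| := by
      by_contra hc
      rw [not_lt, abs_le] at hc
      exact hnot.1 ⟨by linarith, by linarith⟩
    have h2 : 2 * P < |n + m - ξ| := by
      by_contra hc
      rw [not_lt, abs_le] at hc
      exact hnot.2 ⟨by linarith, by linarith⟩
    rw [abs_mul, abs_mul, abs_mul] at hlt
    have h3 : P * (2 * P) ≤ |ξ| * |n - m| := by gcongr
    have h4 : P * (2 * P) * (2 * P) ≤ |ξ| * |n - m| * |n + m - ξ| := by gcongr
    have h5 : 0 < P ^ 3 := by positivity
    rw [abs_of_nonneg (by norm_num : (0 : ℤ) ≤ 3)] at hlt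
    nlinarith

/-! ### Dyadic sums and the interaction kernels -/

theorem two_inv_pow_mul_two_pow (n : ℕ) : (2⁻¹ : ℝ≥0∞) ^ n * 2 ^ n = 1 := by
  rw [← mul_pow, ENNReal.inv_mul_cancel (by norm_num) (by norm_num), one_pow]

theorem two_inv_pow_le {m n : ℕ} (h : m ≤ n) : (2⁻¹ : ℝ≥0∞) ^ n ≤ 2⁻¹ ^ m :=
  pow_le_pow_right_of_le_one' (by norm_num) h

/-- With truncated subtraction the exponent is `|d - k|`, so two geometric series of sum at most 2
appear. -/
theorem tsum_two_inv_pow_dist_le (d : ℕ) :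
    ∑' k : ℕ, (2⁻¹ : ℝ≥0∞) ^ ((d - k) + (k - d)) ≤ 4 := by
  have hg : ∑' k : ℕ, (2⁻¹ : ℝ≥0∞) ^ k = 2 := by
    rw [ENNReal.tsum_geometric, ENNReal.one_sub_inv_two, inv_inv]
  rw [← ENNReal.summable.sum_add_tsum_nat_add' (k := d)]
  have h1 : ∑ k ∈ Finset.range d, (2⁻¹ : ℝ≥0∞) ^ ((d - k) + (k - d)) ≤ 2 := by
    refine le_of_le_of_eq ?_ hg
    rw [← Finset.sum_range_reflect _ d]
    refine le_trans (Finset.sum_le_sum (g := fun k => (2⁻¹ : ℝ≥0∞) ^ k) fun k hk => ?_)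
      (ENNReal.sum_le_tsum (Finset.range d))
    exact two_inv_pow_le (by have := Finset.mem_range.1 hk; omega)
  have h2 : ∑' k : ℕ, (2⁻¹ : ℝ≥0∞) ^ ((d - (k + d)) + (k + d - d)) = 2 := by
    refine Eq.trans (tsum_congr fun k => ?_) hg
    rw [show d - (k + d) + (k + d - d) = k by omega]
  rw [h2]
  calc _ ≤ (2 : ℝ≥0∞) + 2 := by gcongr
    _ = 4 := by norm_num

theorem measurable_level_kernel {α : Type*} [MeasurableSpace α] (A : ℕ → ℕ → ℤ → ℝ≥0∞)
    {i j : α → ℕ} {x : α → ℤ} (hi : Measurable i) (hj : Measurable j) (hx : Measurable x) :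
    Measurable fun z => A (i z) (j z) (x z) :=
  (Measurable.of_discrete (f := fun t : ℕ × ℕ × ℤ => A t.1 t.2.1 t.2.2)).comp
    (hi.prodMk (hj.prodMk hx))

/-- Interactions with low output frequency. -/
noncomputable def lowKernel (i j : ℕ) (x : ℤ) : ℝ≥0∞ :=
  if i ≤ j ∧ |x| < 4 ^ (j + 1) then 2⁻¹ ^ (2 * i + 2 * j) else 0

/-- Interactions with high output frequency. -/
noncomputable def highKernel (i j : ℕ) (x : ℤ) : ℝ≥0∞ :=
  if i ≤ j ∧ 4 ^ (j + 1) ≤ |x| then 2⁻¹ ^ (2 * i + 2 * j) else 0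

/-- The weighted square of `highKernel`. -/
noncomputable def highWeight (i j : ℕ) (x : ℤ) : ℝ≥0∞ :=
  if i ≤ j ∧ 4 ^ (j + 1) ≤ |x| then 2⁻¹ ^ (5 * i + 3 * j) else 0

@[fun_prop]
theorem measurable_lowKernel {α : Type*} [MeasurableSpace α] {i j : α → ℕ} {x : α → ℤ}
    (hi : Measurable i) (hj : Measurable j) (hx : Measurable x) :
    Measurable fun z => lowKernel (i z) (j z) (x z) :=
  measurable_level_kernel lowKernel hi hj hx

@[fun_prop]
theorem measurable_highKernel {α : Type*} [MeasurableSpace α] {i j : α → ℕ} {x : α → ℤ}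
    (hi : Measurable i) (hj : Measurable j) (hx : Measurable x) :
    Measurable fun z => highKernel (i z) (j z) (x z) :=
  measurable_level_kernel highKernel hi hj hx

@[fun_prop]
theorem measurable_highWeight {α : Type*} [MeasurableSpace α] {i j : α → ℕ} {x : α → ℤ}
    (hi : Measurable i) (hj : Measurable j) (hx : Measurable x) :
    Measurable fun z => highWeight (i z) (j z) (x z) :=
  measurable_level_kernel highWeight hi hj hx

/-- With `K` the level of `s`, there are at most `8 * 4 ^ K` output frequencies. Each contributes at
most `2 ^ (-4K) * 256 * 4 ^ K`, and the powers cancel exactly. -/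
theorem lintegral_lowKernel_sq_le (s : ℤ × ℝ) :
    ∫⁻ p, lowKernel (modLevel (p - s)) (modLevel s) p.1 ^ 2 ∂freqMeasure ≤ 2048 := by
  have hm : Measurable fun p : ℤ × ℝ =>
      lowKernel (modLevel (p - s)) (modLevel s) p.1 ^ 2 :=
    (measurable_level_kernel lowKernel (measurable_modLevel.comp (measurable_id.sub_const s))
      measurable_const measurable_fst).pow_const 2
  rw [lintegral_freqMeasure hm]
  set K := modLevel s with hK
  have hT : ((Finset.Ioo (-(4 ^ (K + 1)) : ℤ) (4 ^ (K + 1))).card : ℝ≥0∞) ≤ 8 * 4 ^ K := by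
    rw [Int.card_Ioo]
    have : (4 ^ (K + 1) - -(4 ^ (K + 1) : ℤ) - 1).toNat ≤ 8 * 4 ^ K := by
      rw [Int.toNat_le]; push_cast; rw [pow_succ]; linarith
    exact_mod_cast this
  calc _ ≤ ((Finset.Ioo (-(4 ^ (K + 1)) : ℤ) (4 ^ (K + 1))).card : ℝ≥0∞)
        * (2⁻¹ ^ (4 * K) * (256 * 4 ^ K)) := by
        refine ENNReal.tsum_le_card_mul _ (fun n hn => ?_) (fun n hn => ?_)
        · calc _ ≤ ∫⁻ τ : ℝ, 2⁻¹ ^ (4 * K) * (fun τ' : ℝ =>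
                if modLevel (n - s.1, τ') ≤ K then (2⁻¹ : ℝ≥0∞) ^ (4 * modLevel (n - s.1, τ'))
                  else 0) (τ - s.2) := by
                refine lintegral_mono fun τ => ?_
                dsimp only [lowKernel]
                rw [show ((n, τ) - s : ℤ × ℝ) = (n - s.1, τ - s.2) from rfl]
                by_cases h : modLevel (n - s.1, τ - s.2) ≤ K
                · rw [if_pos h]
                  split_ifs
                  · rw [← pow_mul, ← pow_add]
                    exact two_inv_pow_le (by omega)
                  · simp
                · rw [if_neg h, if_neg (fun h' => h h'.1)]; simp
            _ = 2⁻¹ ^ (4 * K) * _ := by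
                rw [lintegral_const_mul' _ _ (by finiteness), lintegral_sub_right_eq_self
                  (fun τ' : ℝ => if modLevel (n - s.1, τ') ≤ K then
                    (2⁻¹ : ℝ≥0∞) ^ (4 * modLevel (n - s.1, τ')) else 0)]
            _ ≤ _ := by gcongr; exact lintegral_modLevel_four_le _ K
        · have : ¬ |n| < 4 ^ (K + 1) := fun h => hn (Finset.mem_Ioo.2 (abs_lt.1 h))
          simp [lowKernel, this]
    _ ≤ (8 * 4 ^ K) * (2⁻¹ ^ (4 * K) * (256 * 4 ^ K)) := by gcongr
    _ = 2048 * (2⁻¹ ^ (4 * K) * 2 ^ (4 * K)) := by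
        rw [show (4 : ℝ≥0∞) = 2 ^ 2 by norm_num, ← pow_mul]; ring
    _ = 2048 := by rw [two_inv_pow_mul_two_pow, mul_one]

/-- Both modulations are below `64 ^ (k + 1)`, which forces the cubic resonance condition on the
input frequency. The count `4 ^ k`, the factor `2 ^ (-3k)` and the modulation integral `2 ^ k`
cancel. -/
theorem lintegral_highWeight_level_le (p : ℤ × ℝ) (k : ℕ) :
    ∫⁻ q, (if modLevel (p - q) = k then highWeight (modLevel q) k p.1 else 0) ∂freqMeasure
      ≤ 8704 := by
  have hm : Measurable fun q => modLevel (p - q) :=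
    measurable_modLevel.comp (measurable_id.const_sub p)
  have hk : Measurable fun q =>
      (if modLevel (p - q) = k then highWeight (modLevel q) k p.1 else 0) :=
    Measurable.ite (hm (measurableSet_singleton k))
      (measurable_level_kernel highWeight measurable_modLevel measurable_const measurable_const)
      measurable_const
  rw [lintegral_freqMeasure hk]
  by_cases hp : 4 ^ (k + 1) ≤ |p.1|
  swap
  · simp [highWeight, hp]
  obtain ⟨T, hT, hmem⟩ := exists_finset_of_cubic_resonance p.1 p.2 k hp
  calc _ ≤ (T.card : ℝ≥0∞) * (2⁻¹ ^ (3 * k) * (256 * 2 ^ k)) := by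
        refine ENNReal.tsum_le_card_mul _ (fun n hn => ?_) (fun n hn => ?_)
        · calc _ ≤ ∫⁻ τ : ℝ, 2⁻¹ ^ (3 * k) *
                (if modLevel (n, τ) ≤ k then (2⁻¹ : ℝ≥0∞) ^ (5 * modLevel (n, τ)) else 0) := by
                refine lintegral_mono fun τ => ?_
                dsimp only [highWeight]
                by_cases h : modLevel (n, τ) ≤ k
                · simp only [h, true_and, if_true, ← pow_add]
                  split_ifs
                  · exact two_inv_pow_le (by omega)
                  · simp
                · simp [h]
            _ = 2⁻¹ ^ (3 * k) * _ := lintegral_const_mul' _ _ (by finiteness)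
            _ ≤ _ := by gcongr; exact lintegral_modLevel_five_le _ k
        · refine (lintegral_congr fun τ => ?_).trans lintegral_zero
          rw [ite_eq_right_iff]
          intro h1
          refine if_neg fun h2 => hn (hmem n ?_)
          have b1 := abs_lt_pow_modLevel (n, τ)
          have b2 := abs_lt_pow_modLevel (p - (n, τ))
          rw [h1] at b2
          have b3 : (64 : ℝ) ^ (modLevel (n, τ) + 1) ≤ 64 ^ (k + 1) :=
            pow_le_pow_right₀ (by norm_num) (by omega)
          simp only [Prod.snd_sub, Prod.fst_sub, Int.cast_sub] at b1 b2
          rw [show p.2 - (n : ℝ) ^ 3 - ((p.1 : ℝ) - n) ^ 3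
            = (τ - (n : ℝ) ^ 3) + (p.2 - τ - ((p.1 : ℝ) - n) ^ 3) by ring]
          refine (abs_add_le _ _).trans_lt ?_
          linarith
    _ ≤ (34 * 4 ^ k) * (2⁻¹ ^ (3 * k) * (256 * 2 ^ k)) := by
        gcongr; exact_mod_cast hT
    _ = 8704 * (2⁻¹ ^ (3 * k) * 2 ^ (3 * k)) := by
        rw [show (4 : ℝ≥0∞) = 2 ^ 2 by norm_num, ← pow_mul]; ring
    _ = 8704 := by rw [two_inv_pow_mul_two_pow, mul_one]

/-- Each level `k` of `p - q` contributes `O(1)`; the decay in `|d - k|` makes the sum over `k`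
converge. -/
theorem lintegral_highWeight_le (p : ℤ × ℝ) (d : ℕ) :
    ∫⁻ q, highWeight (modLevel q) (modLevel (p - q)) p.1 *
      2⁻¹ ^ ((d - modLevel (p - q)) + (modLevel (p - q) - d)) ∂freqMeasure ≤ 34816 := by
  have hm : Measurable fun q => modLevel (p - q) :=
    measurable_modLevel.comp (measurable_id.const_sub p)
  calc _ ≤ ∫⁻ q, ∑' k : ℕ, 2⁻¹ ^ ((d - k) + (k - d)) *
        (if modLevel (p - q) = k then highWeight (modLevel q) k p.1 else 0) ∂freqMeasure := by
        refine lintegral_mono fun q => ?_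
        refine le_trans (le_of_eq ?_) (ENNReal.le_tsum (modLevel (p - q)))
        rw [if_pos rfl, mul_comm]
    _ = ∑' k : ℕ, 2⁻¹ ^ ((d - k) + (k - d)) * ∫⁻ q,
        (if modLevel (p - q) = k then highWeight (modLevel q) k p.1 else 0) ∂freqMeasure := by
        have hk : ∀ k, Measurable fun q =>
            (if modLevel (p - q) = k then highWeight (modLevel q) k p.1 else 0) := fun k =>
          Measurable.ite (hm (measurableSet_singleton k))
            (measurable_level_kernel _ measurable_modLevel measurable_const measurable_const)
            measurable_const
        rw [lintegral_tsum fun k => ((hk k).const_mul _).aemeasurable]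
        exact tsum_congr fun k => lintegral_const_mul _ (hk k)
    _ ≤ ∑' k : ℕ, 2⁻¹ ^ ((d - k) + (k - d)) * 8704 := by
        gcongr with k; exact lintegral_highWeight_level_le p k
    _ ≤ 4 * 8704 := by
        rw [ENNReal.tsum_mul_right]; gcongr; exact tsum_two_inv_pow_dist_le d
    _ = _ := by norm_num

/-! ### The bilinear estimate -/

theorem lintegral_low_sq_le {G : ℤ × ℝ → ℝ≥0∞} (hG : Measurable G) :
    ∫⁻ p, (∫⁻ q, lowKernel (modLevel q) (modLevel (p - q)) p.1 * (G q * G (p - q)) ∂freqMeasure) ^ 2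
      ∂freqMeasure ≤ 4096 * (∫⁻ q, G q ^ 2 ∂freqMeasure) ^ 2 := by
  have hY : Measurable fun p : ℤ × ℝ => ∫⁻ q,
      lowKernel (modLevel q) (modLevel (p - q)) p.1 ^ 2 * G (p - q) ^ 2 ∂freqMeasure :=
    Measurable.lintegral_prod_right (by fun_prop)
  calc _ ≤ ∫⁻ p, 2 * ((∫⁻ q, G q ^ 2 ∂freqMeasure) *
        ∫⁻ q, lowKernel (modLevel q) (modLevel (p - q)) p.1 ^ 2 * G (p - q) ^ 2 ∂freqMeasure)
        ∂freqMeasure := by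
        refine lintegral_mono fun p => lintegral_sq_le_two_mul (by fun_prop) (by fun_prop)
          (by fun_prop) fun q => le_of_eq ?_
        ring
    _ = 2 * ((∫⁻ q, G q ^ 2 ∂freqMeasure) * ∫⁻ p, ∫⁻ s,
        lowKernel (modLevel (p - s)) (modLevel s) p.1 ^ 2 * G s ^ 2 ∂freqMeasure ∂freqMeasure) := by
        rw [lintegral_const_mul _ (hY.const_mul _), lintegral_const_mul _ hY]
        congr 2
        refine lintegral_congr fun p => ?_
        rw [← lintegral_sub_left_eq_self _ p]
        simp only [sub_sub_cancel]
    _ = 2 * ((∫⁻ q, G q ^ 2 ∂freqMeasure) * ∫⁻ s, (∫⁻ p,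
        lowKernel (modLevel (p - s)) (modLevel s) p.1 ^ 2 ∂freqMeasure) * G s ^ 2 ∂freqMeasure) := by
        rw [lintegral_lintegral_swap (Measurable.aemeasurable (by fun_prop))]
        congr 2
        refine lintegral_congr fun s => ?_
        rw [lintegral_mul_const _ (by fun_prop)]
    _ ≤ 2 * ((∫⁻ q, G q ^ 2 ∂freqMeasure) * ∫⁻ s, 2048 * G s ^ 2 ∂freqMeasure) := by
        gcongr with s; exact lintegral_lowKernel_sq_le s
    _ = _ := by
        rw [lintegral_const_mul _ (hG.pow_const 2)]; ring

/-- Write `ρ i j = 2 ^ (-|i - j|)` and let `c k` be the mass of `G²` weighted by `ρ (level) k`. For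
`i ≤ j` the squared kernel is `ρ i j` times `highWeight`. Cauchy–Schwarz with `ρ / c j` on one side
and `highWeight * c j` on the other works because integrating `G² * ρ` over the first input
reproduces `c j`, while the masses `c k` sum to a multiple of the total mass. -/
theorem lintegral_high_sq_le {G : ℤ × ℝ → ℝ≥0∞} (hG : Measurable G) :
    ∫⁻ p, (∫⁻ q, highKernel (modLevel q) (modLevel (p - q)) p.1 * (G q * G (p - q)) ∂freqMeasure) ^ 2
      ∂freqMeasure ≤ 69632 * (∫⁻ q, G q ^ 2 ∂freqMeasure) ^ 2 := by
  have hG2 := hG.pow_const 2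
  set N := ∫⁻ q, G q ^ 2 ∂freqMeasure with hN
  -- The trivial cases are removed so that every `c k` is nonzero and finite, hence can be
  -- cancelled.
  rcases eq_or_ne N 0 with h0 | h0
  · rw [hN, lintegral_eq_zero_iff hG2] at h0
    have : ∀ p, ∫⁻ q, highKernel (modLevel q) (modLevel (p - q)) p.1 * (G q * G (p - q))
        ∂freqMeasure = 0 := fun p => by
      refine (lintegral_congr_ae ?_).trans lintegral_zero
      filter_upwards [h0] with q hq
      have : G q = 0 := by simpa using hq
      simp [this]
    simp [this]
  rcases eq_or_ne N ∞ with h1 | h1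
  · simp [h1]
  let ρ : ℕ → ℕ → ℝ≥0∞ := fun i j => 2⁻¹ ^ ((i - j) + (j - i))
  have hρ : ∀ {α : Type} [MeasurableSpace α] {i j : α → ℕ}, Measurable i → Measurable j →
      Measurable fun z => ρ (i z) (j z) := fun hi hj =>
    (Measurable.of_discrete (f := fun t : ℕ × ℕ => ρ t.1 t.2)).comp (hi.prodMk hj)
  have hρ1 : ∀ k, Measurable fun s => ρ (modLevel s) k := fun k =>
    hρ measurable_modLevel measurable_const
  obtain ⟨c, hc⟩ : ∃ c : ℕ → ℝ≥0∞, ∀ k,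
      c k = ∫⁻ s, G s ^ 2 * ρ (modLevel s) k ∂freqMeasure := ⟨_, fun _ => rfl⟩
  have hc1 : ∀ k, c k ≠ ∞ := fun k => by
    rw [hc]
    refine ne_top_of_le_ne_top h1 (lintegral_mono fun s => ?_)
    exact mul_le_of_le_one_right' (pow_le_one' (by norm_num) _)
  have hc0 : ∀ k, c k ≠ 0 := fun k h => by
    have hm : Measurable fun s => G s ^ 2 * ρ (modLevel s) k := hG2.mul (hρ1 k)
    rw [hc, lintegral_eq_zero_iff hm] at h
    refine h0 ((lintegral_eq_zero_iff hG2).2 ?_)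
    filter_upwards [h] with s hs
    simpa [ρ] using hs
  have hcm : Measurable c := .of_discrete
  have hρa : Measurable fun z : (ℤ × ℝ) × (ℤ × ℝ) => ρ (modLevel z.2) (modLevel (z.1 - z.2)) :=
    hρ (by fun_prop) (by fun_prop)
  have hρb : Measurable fun z : (ℤ × ℝ) × (ℤ × ℝ) => ρ (modLevel (z.1 - z.2)) (modLevel z.2) :=
    hρ (by fun_prop) (by fun_prop)
  have hρc : ∀ p : ℤ × ℝ, Measurable fun q => ρ (modLevel q) (modLevel (p - q)) := fun p =>
    hρ (by fun_prop) (by fun_prop)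
  have hX : Measurable fun p : ℤ × ℝ => ∫⁻ q, G q ^ 2 * (G (p - q) ^ 2 *
        ρ (modLevel q) (modLevel (p - q)) * (c (modLevel (p - q)))⁻¹) ∂freqMeasure :=
    Measurable.lintegral_prod_right (by fun_prop)
  have hYle : ∀ p, ∫⁻ q, highWeight (modLevel q) (modLevel (p - q)) p.1 * c (modLevel (p - q))
      ∂freqMeasure ≤ 34816 * N := fun p => by
    have hρd : Measurable fun z : (ℤ × ℝ) × (ℤ × ℝ) => ρ (modLevel z.2) (modLevel (p - z.1)) :=
      hρ (by fun_prop) (by fun_prop)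
    have hρe : ∀ s, Measurable fun q : ℤ × ℝ => ρ (modLevel s) (modLevel (p - q)) := fun s =>
      hρ (by fun_prop) (by fun_prop)
    calc _ = ∫⁻ q, ∫⁻ s, highWeight (modLevel q) (modLevel (p - q)) p.1 * (G s ^ 2 *
          ρ (modLevel s) (modLevel (p - q))) ∂freqMeasure ∂freqMeasure := by
          refine lintegral_congr fun q => ?_
          have := hρ1 (modLevel (p - q))
          rw [lintegral_const_mul _ (by fun_prop), hc]
      _ = ∫⁻ s, G s ^ 2 * ∫⁻ q, highWeight (modLevel q) (modLevel (p - q)) p.1 *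
          ρ (modLevel s) (modLevel (p - q)) ∂freqMeasure ∂freqMeasure := by
          rw [lintegral_lintegral_swap (Measurable.aemeasurable (by fun_prop))]
          refine lintegral_congr fun s => ?_
          have := hρe s
          rw [← lintegral_const_mul _ (by fun_prop)]
          refine lintegral_congr fun q => ?_
          ring
      _ ≤ ∫⁻ s, G s ^ 2 * 34816 ∂freqMeasure := by
          gcongr with s; exact lintegral_highWeight_le p (modLevel s)
      _ = _ := by rw [lintegral_mul_const _ hG2, mul_comm]
  have hXle : ∫⁻ p, ∫⁻ q, G q ^ 2 * (G (p - q) ^ 2 *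
        ρ (modLevel q) (modLevel (p - q)) * (c (modLevel (p - q)))⁻¹) ∂freqMeasure ∂freqMeasure
        ≤ N := by
    calc _ = ∫⁻ p, ∫⁻ r, G (p - r) ^ 2 * (G r ^ 2 *
        ρ (modLevel (p - r)) (modLevel r) * (c (modLevel r))⁻¹) ∂freqMeasure ∂freqMeasure := by
          refine lintegral_congr fun p => ?_
          rw [← lintegral_sub_left_eq_self _ p]
          simp only [sub_sub_cancel]
      _ = ∫⁻ r, ∫⁻ p, G (p - r) ^ 2 * (G r ^ 2 *
        ρ (modLevel (p - r)) (modLevel r) * (c (modLevel r))⁻¹) ∂freqMeasure ∂freqMeasure :=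
          lintegral_lintegral_swap (Measurable.aemeasurable (by fun_prop))
      _ = ∫⁻ r, G r ^ 2 * (c (modLevel r))⁻¹ * c (modLevel r) ∂freqMeasure := by
          refine lintegral_congr fun r => ?_
          have : Measurable fun p => ρ (modLevel (p - r)) (modLevel r) :=
            hρ (by fun_prop) measurable_const
          have hcr : c (modLevel r) = ∫⁻ p, G (p - r) ^ 2 * ρ (modLevel (p - r)) (modLevel r)
              ∂freqMeasure :=
            (hc _).trans (lintegral_sub_right_eq_self
              (fun s => G s ^ 2 * ρ (modLevel s) (modLevel r)) r).symm
          rw [mul_comm _ (c (modLevel r))]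
          nth_rw 2 [hcr]
          rw [← lintegral_mul_const _ (by fun_prop)]
          refine lintegral_congr fun p => ?_
          ring
      _ ≤ _ := by
          refine lintegral_mono fun r => ?_
          dsimp only
          rw [mul_assoc, ENNReal.inv_mul_cancel (hc0 _) (hc1 _), mul_one]
  calc _ ≤ ∫⁻ p, 2 * ((∫⁻ q, G q ^ 2 * (G (p - q) ^ 2 *
        ρ (modLevel q) (modLevel (p - q)) * (c (modLevel (p - q)))⁻¹) ∂freqMeasure) *
        ∫⁻ q, highWeight (modLevel q) (modLevel (p - q)) p.1 * c (modLevel (p - q))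
          ∂freqMeasure) ∂freqMeasure := by
        refine lintegral_mono fun p => lintegral_sq_le_two_mul ?_ (by fun_prop)
          (by fun_prop) fun q => ?_
        · have := hρc p
          fun_prop
        unfold highKernel highWeight
        split_ifs with h
        · calc _ = G q ^ 2 * G (p - q) ^ 2 *
              (2⁻¹ : ℝ≥0∞) ^ (4 * modLevel q + 4 * modLevel (p - q)) := by ring
            _ = G q ^ 2 * G (p - q) ^ 2 *
              (ρ (modLevel q) (modLevel (p - q)) * 2⁻¹ ^ (5 * modLevel q + 3 * modLevel (p - q))) *
              ((c (modLevel (p - q)))⁻¹ * c (modLevel (p - q))) := by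
                rw [ENNReal.inv_mul_cancel (hc0 _) (hc1 _), mul_one, ← pow_add]
                congr 2
                -- Uses `i ≤ j`: then `(i - j) + (j - i) + (5i + 3j) = 4i + 4j`.
                omega
            _ ≤ _ := le_of_eq (by ring)
        · simp
    _ ≤ ∫⁻ p, 2 * ((∫⁻ q, G q ^ 2 * (G (p - q) ^ 2 *
        ρ (modLevel q) (modLevel (p - q)) * (c (modLevel (p - q)))⁻¹) ∂freqMeasure) *
        (34816 * N)) ∂freqMeasure := by
        gcongr with p; exact hYle p
    _ = 2 * ((∫⁻ p, ∫⁻ q, G q ^ 2 * (G (p - q) ^ 2 *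
        ρ (modLevel q) (modLevel (p - q)) * (c (modLevel (p - q)))⁻¹) ∂freqMeasure ∂freqMeasure) *
        (34816 * N)) := by
        rw [lintegral_const_mul _ (hX.mul_const _), lintegral_mul_const _ hX]
    _ ≤ 2 * (N * (34816 * N)) := by gcongr
    _ = _ := by ring

/-- The reflection `q ↦ p - q` preserves the product and exchanges the two level orderings. -/
theorem lintegral_mul_sub_le_two_mul (p : ℤ × ℝ) {F : ℤ × ℝ → ℝ≥0∞} (hF : Measurable F) :
    ∫⁻ q, F q * F (p - q) ∂freqMeasure ≤ 2 * ∫⁻ q,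
      (if modLevel q ≤ modLevel (p - q) then F q * F (p - q) else 0) ∂freqMeasure := by
  obtain ⟨H, hH⟩ : ∃ H : ℤ × ℝ → ℝ≥0∞, ∀ q,
      H q = if modLevel q ≤ modLevel (p - q) then F q * F (p - q) else 0 := ⟨_, fun _ => rfl⟩
  have hm : Measurable H := by
    rw [funext hH]
    exact Measurable.ite (measurableSet_le (by fun_prop) (by fun_prop)) (by fun_prop)
      measurable_const
  simp_rw [← hH]
  calc _ ≤ ∫⁻ q, (H q + H (p - q)) ∂freqMeasure := by
        refine lintegral_mono fun q => ?_
        dsimp only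
        rw [hH, hH, sub_sub_cancel]
        rcases le_total (modLevel q) (modLevel (p - q)) with h | h
        · rw [if_pos h]; exact le_self_add
        · rw [if_pos h, mul_comm]; exact le_add_self
    _ = _ := by
        rw [lintegral_add_left hm, lintegral_sub_left_eq_self H p, two_mul]

/-- The `L²` bound for the self-convolution of a function on frequency space. -/
theorem lintegral_conv_sq_le {F : ℤ × ℝ → ℝ≥0∞} (hF : Measurable F) :
    ∫⁻ p, (∫⁻ q, F q * F (p - q) ∂freqMeasure) ^ 2 ∂freqMeasure
      ≤ 884736 * (∫⁻ q, (4 ^ modLevel q * F q) ^ 2 ∂freqMeasure) ^ 2 := by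
  obtain ⟨G, hGdef⟩ : ∃ G : ℤ × ℝ → ℝ≥0∞, ∀ q, G q = 4 ^ modLevel q * F q := ⟨_, fun _ => rfl⟩
  have hG : Measurable G := by
    rw [funext hGdef]
    exact ((Measurable.of_discrete (f := fun n : ℕ => (4 : ℝ≥0∞) ^ n)).comp
      measurable_modLevel).mul hF
  have hFG : ∀ q, F q = 2⁻¹ ^ (2 * modLevel q) * G q := fun q => by
    rw [hGdef, ← mul_assoc, show (4 : ℝ≥0∞) = 2 ^ 2 by norm_num, ← pow_mul,
      two_inv_pow_mul_two_pow, one_mul]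
  simp_rw [← hGdef]
  obtain ⟨A, hA⟩ : ∃ A : ℤ × ℝ → ℝ≥0∞, ∀ p, A p = ∫⁻ q,
      lowKernel (modLevel q) (modLevel (p - q)) p.1 * (G q * G (p - q)) ∂freqMeasure :=
    ⟨_, fun _ => rfl⟩
  obtain ⟨B, hB⟩ : ∃ B : ℤ × ℝ → ℝ≥0∞, ∀ p, B p = ∫⁻ q,
      highKernel (modLevel q) (modLevel (p - q)) p.1 * (G q * G (p - q)) ∂freqMeasure :=
    ⟨_, fun _ => rfl⟩
  have hAm : Measurable A := by
    rw [funext hA]; exact Measurable.lintegral_prod_right (by fun_prop)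
  have hBm : Measurable B := by
    rw [funext hB]; exact Measurable.lintegral_prod_right (by fun_prop)
  have hA2 := lintegral_low_sq_le hG
  have hB2 := lintegral_high_sq_le hG
  simp_rw [← hA] at hA2
  simp_rw [← hB] at hB2
  have key : ∀ p, ∫⁻ q, F q * F (p - q) ∂freqMeasure ≤ 2 * (A p + B p) := fun p => by
    refine (lintegral_mul_sub_le_two_mul p hF).trans ?_
    gcongr
    rw [hA, hB, ← lintegral_add_left (by fun_prop)]
    refine lintegral_mono fun q => ?_
    dsimp only
    split_ifs with h
    · unfold lowKernel highKernel
      rw [hFG q, hFG (p - q)]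
      rcases lt_or_ge |p.1| (4 ^ (modLevel (p - q) + 1)) with h' | h'
      · rw [if_pos ⟨h, h'⟩]
        exact le_trans (le_of_eq (by ring)) le_self_add
      · rw [if_pos (⟨h, h'⟩ : modLevel q ≤ _ ∧ _)]
        exact le_trans (le_of_eq (by ring)) le_add_self
    · exact zero_le
  calc _ ≤ ∫⁻ p, 12 * (A p ^ 2 + B p ^ 2) ∂freqMeasure := by
        refine lintegral_mono fun p => ?_
        calc _ ≤ (2 * (A p + B p)) ^ 2 := by gcongr; exact key p
          _ = 4 * (A p + B p) ^ 2 := by rw [mul_pow]; norm_num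
          _ ≤ 4 * (3 * (A p ^ 2 + B p ^ 2)) := by gcongr; exact ENNReal.add_sq_le _ _
          _ = _ := by ring
    _ = 12 * ((∫⁻ p, A p ^ 2 ∂freqMeasure) + ∫⁻ p, B p ^ 2 ∂freqMeasure) := by
        rw [lintegral_const_mul _ (by fun_prop), lintegral_add_left (by fun_prop)]
    _ ≤ 12 * (4096 * (∫⁻ q, G q ^ 2 ∂freqMeasure) ^ 2 +
        69632 * (∫⁻ q, G q ^ 2 ∂freqMeasure) ^ 2) := by gcongr
    _ = _ := by ring

/-! ### Space-time trigonometric sums -/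

theorem UnitAddCircle.volume_eq_haarAddCircle :
    (volume : Measure UnitAddCircle) = AddCircle.haarAddCircle := by
  rw [AddCircle.volume_eq_smul_haarAddCircle]; simp

theorem integral_fourier (n : ℤ) :
    ∫ x : UnitAddCircle, fourier n x = if n = 0 then 1 else 0 := by
  have h := congrFun (fourierCoeff_fourier (T := 1) n) 0
  rw [fourierCoeff, ← UnitAddCircle.volume_eq_haarAddCircle] at h
  simp only [neg_zero, fourier_zero, one_smul] at h
  rw [h, Pi.single_apply]
  simp [eq_comm]

theorem lintegral_enorm_sq_trigPoly (T : Finset ℤ) (a : ℤ → ℂ) :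
    ∫⁻ x : UnitAddCircle, ‖∑ n ∈ T, a n * fourier n x‖ₑ ^ 2 = ∑ n ∈ T, ‖a n‖ₑ ^ 2 := by
  have hc : Continuous fun x : UnitAddCircle => ∑ n ∈ T, a n * fourier n x := by fun_prop
  have hi : ∀ f : UnitAddCircle → ℂ, Continuous f → Integrable f := fun f hf =>
    hf.integrable_of_hasCompactSupport (HasCompactSupport.of_compactSpace f)
  have key : ∫ x : UnitAddCircle, ‖∑ n ∈ T, a n * fourier n x‖ ^ 2 = ∑ n ∈ T, ‖a n‖ ^ 2 := by
    apply Complex.ofReal_injective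
    rw [← integral_complex_ofReal]
    have e : ∀ x : UnitAddCircle, ((‖∑ n ∈ T, a n * fourier n x‖ ^ 2 : ℝ) : ℂ)
        = ∑ n ∈ T, ∑ m ∈ T, a n * (starRingEnd ℂ) (a m) * fourier (n - m) x := fun x => by
      push_cast
      rw [← Complex.mul_conj', map_sum, Finset.sum_mul_sum]
      refine Finset.sum_congr rfl fun n _ => Finset.sum_congr rfl fun m _ => ?_
      rw [map_mul, ← fourier_neg, sub_eq_add_neg, fourier_add]
      ring
    simp_rw [e]
    rw [integral_finsetSum _ fun n _ => hi _ (by fun_prop)]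
    push_cast
    refine Finset.sum_congr rfl fun n hn => ?_
    rw [integral_finsetSum _ fun m _ => hi _ (by fun_prop)]
    simp_rw [integral_const_mul, integral_fourier, sub_eq_zero]
    simp [hn, Complex.mul_conj']
  have h1 : ∀ z : ℂ, ‖z‖ₑ ^ 2 = ENNReal.ofReal (‖z‖ ^ 2) := fun z => by
    rw [ENNReal.ofReal_pow (norm_nonneg _), ofReal_norm]
  simp_rw [h1]
  rw [← ofReal_integral_eq_lintegral_ofReal, key, ENNReal.ofReal_sum_of_nonneg]
  · intros; positivity
  · exact (show Continuous _ by fun_prop : Continuous fun x : UnitAddCircle =>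
      ‖∑ n ∈ T, a n * fourier n x‖ ^ 2).integrable_of_hasCompactSupport
        (HasCompactSupport.of_compactSpace _)
  · exact Filter.Eventually.of_forall fun _ => by positivity

theorem SchwartzMap.fourierInv_mul_fourierInv (f g : 𝓢(ℝ, ℂ)) (t : ℝ) :
    (𝓕⁻ f) t * (𝓕⁻ g) t = (𝓕⁻ (SchwartzMap.convolution (ContinuousLinearMap.mul ℂ ℂ) f g)) t := by
  have h : ∀ k : 𝓢(ℝ, ℂ), (𝓕⁻ k) t = (𝓕 k) (-t) := fun k => by
    rw [fourierInv_coe, fourier_coe, Real.fourierInv_eq_fourier_neg]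
  rw [h, h, h, SchwartzMap.fourier_convolution]
  simp

theorem SchwartzMap.lintegral_enorm_sq_fourierInv (f : 𝓢(ℝ, ℂ)) :
    ∫⁻ t, ‖(𝓕⁻ f) t‖ₑ ^ 2 = ∫⁻ τ, ‖f τ‖ₑ ^ 2 := by
  have h := SchwartzMap.integral_norm_sq_fourier (𝓕⁻ f)
  rw [FourierTransform.fourier_fourierInv_eq] at h
  have h1 : ∀ z : ℂ, ‖z‖ₑ ^ 2 = ENNReal.ofReal (‖z‖ ^ 2) := fun z => by
    rw [ENNReal.ofReal_pow (norm_nonneg _), ofReal_norm]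
  have hi : ∀ f : 𝓢(ℝ, ℂ), Integrable fun t => ‖f t‖ ^ 2 := fun f =>
    (memLp_two_iff_integrable_sq_norm f.continuous.aestronglyMeasurable).1 (f.memLp 2)
  simp_rw [h1]
  rw [← ofReal_integral_eq_lintegral_ofReal (hi _) (Filter.Eventually.of_forall fun _ => by positivity),
    ← ofReal_integral_eq_lintegral_ofReal (hi _) (Filter.Eventually.of_forall fun _ => by positivity), h]

/-- The function on `𝕋 × ℝ` with Fourier transform `h`, for `h` supported in `S × ℝ`. -/
noncomputable def fourierSum (S : Finset ℤ) (h : ℤ → 𝓢(ℝ, ℂ)) (p : UnitAddCircle × ℝ) : ℂ :=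
  ∑ ξ ∈ S, (𝓕⁻ (h ξ)) p.2 * fourier ξ p.1

theorem continuous_fourierSum (S : Finset ℤ) (h : ℤ → 𝓢(ℝ, ℂ)) : Continuous (fourierSum S h) := by
  unfold fourierSum
  refine continuous_finsetSum _ fun ξ _ => ?_
  exact ((𝓕⁻ (h ξ)).continuous.comp continuous_snd).mul ((fourier ξ).continuous.comp continuous_fst)

/-- The convolution square of `h` on `ℤ × ℝ`. -/
noncomputable def convSquare (S : Finset ℤ) (h : ℤ → 𝓢(ℝ, ℂ)) (n : ℤ) : 𝓢(ℝ, ℂ) :=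
  ∑ ξ ∈ S, SchwartzMap.convolution (ContinuousLinearMap.mul ℂ ℂ) (h ξ) (h (n - ξ))

/-- Products of inverse transforms become convolutions in `τ`, and grouping characters by `n = ξ +
η` gives the convolution in `ξ`. Vanishing off `S` lets the inner sum run over all of `S + S`. -/
theorem fourierSum_sq {S : Finset ℤ} {h : ℤ → 𝓢(ℝ, ℂ)} (hS : ∀ ξ ∉ S, h ξ = 0)
    (x : UnitAddCircle) (t : ℝ) :
    fourierSum S h (x, t) ^ 2 =
      ∑ n ∈ Finset.image₂ (· + ·) S S, (𝓕⁻ (convSquare S h n)) t * fourier n x := by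
  have e : ∀ n, (𝓕⁻ (convSquare S h n)) t = ∑ ξ ∈ S, (𝓕⁻ (h ξ)) t * (𝓕⁻ (h (n - ξ))) t := fun n => by
    simp_rw [SchwartzMap.fourierInv_mul_fourierInv]
    have := map_sum (FourierTransform.fourierInvCLM ℂ 𝓢(ℝ, ℂ)) (fun ξ =>
      SchwartzMap.convolution (ContinuousLinearMap.mul ℂ ℂ) (h ξ) (h (n - ξ))) S
    simp only [FourierTransform.fourierInvCLM_apply] at this
    rw [convSquare, this, _root_.sum_apply]
  simp_rw [e, Finset.sum_mul]
  rw [Finset.sum_comm, sq]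
  unfold fourierSum
  rw [Finset.sum_mul_sum]
  refine Finset.sum_congr rfl fun ξ hξ => ?_
  symm
  rw [← Finset.sum_subset (s₁ := S.image (ξ + ·))]
  · rw [Finset.sum_image fun _ _ _ _ => add_left_cancel]
    refine Finset.sum_congr rfl fun η _ => ?_
    rw [add_sub_cancel_left, fourier_add]
    ring
  · intro n hn
    obtain ⟨η, hη, rfl⟩ := Finset.mem_image.1 hn
    exact Finset.mem_image₂_of_mem hξ hη
  · intro n _ hn
    have : h (n - ξ) = 0 := hS _ fun hc => hn (Finset.mem_image.2 ⟨_, hc, by ring⟩)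
    have h0 := map_zero (FourierTransform.fourierInvCLM ℂ 𝓢(ℝ, ℂ))
    simp only [FourierTransform.fourierInvCLM_apply] at h0
    rw [this, h0]
    simp

theorem enorm_convSquare_le (S : Finset ℤ) (h : ℤ → 𝓢(ℝ, ℂ)) (p : ℤ × ℝ)
    (hm : Measurable fun q : ℤ × ℝ => ‖h q.1 q.2‖ₑ) :
    ‖convSquare S h p.1 p.2‖ₑ
      ≤ ∫⁻ q, ‖h q.1 q.2‖ₑ * ‖h (p - q).1 (p - q).2‖ₑ ∂freqMeasure := by
  have hmm : Measurable fun q : ℤ × ℝ => ‖h q.1 q.2‖ₑ * ‖h (p - q).1 (p - q).2‖ₑ :=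
    hm.mul (hm.comp (measurable_id.const_sub p))
  rw [lintegral_freqMeasure hmm]
  unfold convSquare
  rw [_root_.sum_apply]
  refine (enorm_sum_le _ _).trans (le_trans (Finset.sum_le_sum fun ξ _ => ?_)
    (ENNReal.sum_le_tsum S))
  rw [SchwartzMap.convolution_apply]
  unfold convolution
  refine (enorm_integral_le_lintegral_enorm _).trans (le_of_eq ?_)
  refine lintegral_congr fun s => ?_
  simp

theorem measurable_freq_of_continuous {F : ℤ × ℝ → ℝ≥0∞} (h : ∀ n, Continuous fun τ => F (n, τ)) :
    Measurable F :=
  measurable_from_prod_countable_right fun n => (h n).measurable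

theorem lintegral_fourierSum_le {S : Finset ℤ} {h : ℤ → 𝓢(ℝ, ℂ)} (hS : ∀ ξ ∉ S, h ξ = 0) :
    ∫⁻ p, ‖fourierSum S h p‖ₑ ^ 4 ≤
      884736 * (∫⁻ q, (4 ^ modLevel q * ‖h q.1 q.2‖ₑ) ^ 2 ∂freqMeasure) ^ 2 := by
  have hm : Measurable fun q : ℤ × ℝ => ‖h q.1 q.2‖ₑ :=
    measurable_freq_of_continuous fun n => (h n).continuous.enorm
  have hm2 : Measurable fun q : ℤ × ℝ => ‖convSquare S h q.1 q.2‖ₑ ^ 2 :=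
    (measurable_freq_of_continuous fun n => (convSquare S h n).continuous.enorm).pow_const 2
  calc _ = ∫⁻ t : ℝ, ∫⁻ x : UnitAddCircle, ‖fourierSum S h (x, t)‖ₑ ^ 4 := by
        rw [Measure.volume_eq_prod, lintegral_prod_symm]
        exact ((continuous_fourierSum S h).enorm.measurable.pow_const 4).aemeasurable
    _ = ∫⁻ t : ℝ, ∑ n ∈ Finset.image₂ (· + ·) S S, ‖(𝓕⁻ (convSquare S h n)) t‖ₑ ^ 2 := by
        refine lintegral_congr fun t => ?_
        rw [← lintegral_enorm_sq_trigPoly]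
        refine lintegral_congr fun x => ?_
        rw [← fourierSum_sq hS, enorm_pow, ← pow_mul]
    _ = ∑ n ∈ Finset.image₂ (· + ·) S S, ∫⁻ τ : ℝ, ‖convSquare S h n τ‖ₑ ^ 2 := by
        rw [lintegral_finsetSum _ fun n _ => ((𝓕⁻ (convSquare S h n)).continuous.enorm.measurable).pow_const 2]
        simp_rw [SchwartzMap.lintegral_enorm_sq_fourierInv]
    _ ≤ ∫⁻ p, ‖convSquare S h p.1 p.2‖ₑ ^ 2 ∂freqMeasure := by
        rw [lintegral_freqMeasure hm2]
        exact ENNReal.sum_le_tsum _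
    _ ≤ ∫⁻ p, (∫⁻ q, ‖h q.1 q.2‖ₑ * ‖h (p - q).1 (p - q).2‖ₑ ∂freqMeasure) ^ 2 ∂freqMeasure := by
        gcongr with p; exact enorm_convSquare_le S h p hm
    _ ≤ _ := lintegral_conv_sq_le hm

/-! ### The weighted norm on frequency space and its dense subspace of Schwartz sums -/

/-- The weight `⟨τ - ξ³⟩ ^ (1/3)`. -/
noncomputable def kdvWeight (q : ℤ × ℝ) : ℝ := bracket (q.2 - (q.1 : ℝ) ^ 3) ^ (1 / 3 : ℝ)

/-- The norm `‖⟨τ - ξ³⟩ ^ (1/3) g‖` of `L²(ℤ × ℝ)`. -/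
noncomputable def kdvNorm (g : ℤ × ℝ → ℂ) : ℝ≥0∞ :=
  eLpNorm (fun q => (kdvWeight q : ℂ) * g q) 2 freqMeasure

theorem kdvWeight_pos (q : ℤ × ℝ) : 0 < kdvWeight q := Real.rpow_pos_of_pos (bracket_pos _) _

theorem one_le_kdvWeight (q : ℤ × ℝ) : 1 ≤ kdvWeight q :=
  Real.one_le_rpow (one_le_bracket _) (by norm_num)

theorem measurable_kdvWeight : Measurable kdvWeight := by
  refine Measurable.pow_const (continuous_bracket.measurable.comp (measurable_snd.sub ?_)) _
  exact (Measurable.of_discrete (f := fun n : ℤ => (n : ℝ) ^ 3)).comp measurable_fst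

theorem contDiff_kdvWeight (n : ℤ) : ContDiff ℝ ((⊤ : ℕ∞) : WithTop ℕ∞) fun τ : ℝ => kdvWeight (n, τ) := by
  unfold kdvWeight bracket
  simp only [sq_abs]
  have h : ∀ τ : ℝ, 0 < 1 + (τ - (n : ℝ) ^ 3) ^ 2 := fun τ => by positivity
  exact ContDiff.rpow_const_of_ne (ContDiff.rpow_const_of_ne (by fun_prop) fun τ => (h τ).ne')
    fun τ => (Real.rpow_pos_of_pos (h τ) _).ne'

theorem four_pow_modLevel_le (q : ℤ × ℝ) : (4 : ℝ≥0∞) ^ modLevel q ≤ ‖(kdvWeight q : ℂ)‖ₑ := by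
  have h : (4 : ℝ) ^ modLevel q ≤ kdvWeight q := by
    calc (4 : ℝ) ^ modLevel q = ((64 : ℝ) ^ modLevel q) ^ (1 / 3 : ℝ) := by
          rw [show (64 : ℝ) = 4 ^ 3 by norm_num, ← pow_mul, mul_comm, pow_mul,
            show (1 / 3 : ℝ) = ((3 : ℕ) : ℝ)⁻¹ by norm_num,
            Real.pow_rpow_inv_natCast (by positivity) (by norm_num)]
      _ ≤ _ := Real.rpow_le_rpow (by positivity) (pow_modLevel_le q) (by norm_num)
  rw [← ofReal_norm, Complex.norm_real, Real.norm_of_nonneg (kdvWeight_pos q).le]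
  calc (4 : ℝ≥0∞) ^ modLevel q = ENNReal.ofReal (4 ^ modLevel q) := by
        rw [ENNReal.ofReal_pow (by norm_num)]; norm_num
    _ ≤ _ := ENNReal.ofReal_le_ofReal h

theorem eLpNorm_natCast_pow {α : Type*} [MeasurableSpace α] {μ : Measure α} (f : α → ℂ) (n : ℕ)
    [NeZero n] : eLpNorm f n μ ^ n = ∫⁻ x, ‖f x‖ₑ ^ n ∂μ := by
  have h := eLpNorm_nnreal_pow_eq_lintegral (μ := μ) (f := f) (p := (n : ℝ≥0)) (NeZero.ne _)
  simpa using h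

theorem eLpNorm_fourierSum_le {S : Finset ℤ} {h : ℤ → 𝓢(ℝ, ℂ)} (hS : ∀ ξ ∉ S, h ξ = 0) :
    eLpNorm (fourierSum S h) 4 volume ≤ 31 * kdvNorm fun q => h q.1 q.2 := by
  rw [← ENNReal.pow_le_pow_left_iff four_ne_zero]
  have h4 := eLpNorm_natCast_pow (μ := volume) (fourierSum S h) 4
  have h2 := eLpNorm_natCast_pow (μ := freqMeasure) (fun q => (kdvWeight q : ℂ) * h q.1 q.2) 2
  norm_num at h4 h2
  calc _ ≤ _ := h4.le.trans (lintegral_fourierSum_le hS)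
    _ ≤ 884736 * (∫⁻ q, (‖(kdvWeight q : ℂ)‖ₑ * ‖h q.1 q.2‖ₑ) ^ 2 ∂freqMeasure) ^ 2 := by
        gcongr with q; exact four_pow_modLevel_le q
    _ = 884736 * (kdvNorm (fun q => h q.1 q.2) ^ 2) ^ 2 := by
        rw [kdvNorm, h2]
    -- `923521 = 31 ^ 4` is the first integer fourth power above `884736`.
    _ ≤ 923521 * (kdvNorm (fun q => h q.1 q.2) ^ 2) ^ 2 := by
        gcongr; norm_num
    _ = _ := by rw [mul_pow, ← pow_mul]; norm_num

/-- Approximate the weighted function in `L²` by a test function and divide by the weight, which is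
smooth and positive, so the quotient is again a test function. -/
theorem exists_schwartz_approx (n : ℤ) {f : ℝ → ℂ} (hf : AEStronglyMeasurable f)
    (hfin : ∫⁻ τ, ‖(kdvWeight (n, τ) : ℂ) * f τ‖ₑ ^ 2 ≠ ∞) {δ : ℝ≥0∞} (hδ : δ ≠ 0) :
    ∃ k : 𝓢(ℝ, ℂ), ∫⁻ τ, ‖(kdvWeight (n, τ) : ℂ) * (k τ - f τ)‖ₑ ^ 2 ≤ δ := by
  have hw := contDiff_kdvWeight n
  have hwm : Continuous fun τ : ℝ => (kdvWeight (n, τ) : ℂ) :=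
    Complex.continuous_ofReal.comp hw.continuous
  have hF : MemLp (fun τ => (kdvWeight (n, τ) : ℂ) * f τ) 2 := by
    refine ⟨hwm.aestronglyMeasurable.mul hf, ?_⟩
    have h2 := eLpNorm_natCast_pow (μ := volume) (fun τ => (kdvWeight (n, τ) : ℂ) * f τ) 2
    norm_num at h2 hfin
    rw [← h2] at hfin
    exact (ENNReal.pow_ne_top_iff.1 hfin).resolve_right (by norm_num) |>.lt_top
  obtain ⟨ε, hε, hεδ⟩ : ∃ ε : ℝ, 0 < ε ∧ ENNReal.ofReal ε ^ 2 ≤ δ := by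
    rcases eq_or_ne δ ∞ with rfl | hδ'
    · exact ⟨1, one_pos, le_top⟩
    · refine ⟨Real.sqrt δ.toReal, Real.sqrt_pos.2 (ENNReal.toReal_pos hδ hδ'), ?_⟩
      rw [← ENNReal.ofReal_pow (Real.sqrt_nonneg _), Real.sq_sqrt ENNReal.toReal_nonneg,
        ENNReal.ofReal_toReal hδ']
  obtain ⟨φ, hφ1, hφ2, hφ3⟩ := hF.exist_eLpNorm_sub_le (by norm_num) (by norm_num) hε
  have hk1 : HasCompactSupport fun τ => (((kdvWeight (n, τ))⁻¹ : ℝ) : ℂ) * φ τ := hφ1.mul_left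
  have hk2 : ContDiff ℝ ((⊤ : ℕ∞) : WithTop ℕ∞) fun τ => (((kdvWeight (n, τ))⁻¹ : ℝ) : ℂ) * φ τ :=
    (Complex.ofRealCLM.contDiff.comp (hw.inv fun τ => (kdvWeight_pos _).ne')).mul hφ2
  refine ⟨hk1.toSchwartzMap hk2, ?_⟩
  have h2 := eLpNorm_natCast_pow (μ := volume) ((fun τ => (kdvWeight (n, τ) : ℂ) * f τ) - φ) 2
  norm_num at h2
  calc _ = ∫⁻ τ, ‖(kdvWeight (n, τ) : ℂ) * f τ - φ τ‖ₑ ^ 2 := by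
        refine lintegral_congr fun τ => ?_
        rw [HasCompactSupport.toSchwartzMap_toFun, ← enorm_neg]
        congr 2
        have : (kdvWeight (n, τ) : ℂ) ≠ 0 := Complex.ofReal_ne_zero.2 (kdvWeight_pos _).ne'
        push_cast
        field_simp
        ring
    _ = _ := h2.symm
    _ ≤ ENNReal.ofReal ε ^ 2 := by gcongr
    _ ≤ δ := hεδ

theorem lintegral_freqMeasure' {f : ℤ × ℝ → ℝ≥0∞} (hf : AEMeasurable f freqMeasure) :
    ∫⁻ q, f q ∂freqMeasure = ∑' n : ℤ, ∫⁻ τ : ℝ, f (n, τ) := by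
  rw [freqMeasure, lintegral_prod _ hf, lintegral_count]

theorem aestronglyMeasurable_freq_slice {g : ℤ × ℝ → ℂ} (hg : AEStronglyMeasurable g freqMeasure)
    (n : ℤ) : AEStronglyMeasurable fun τ : ℝ => g (n, τ) :=
  Measure.ae_count_iff.1 (AEStronglyMeasurable.prodMk_left hg) n

theorem measurable_schwartz_family (h : ℤ → 𝓢(ℝ, ℂ)) : Measurable fun q : ℤ × ℝ => h q.1 q.2 :=
  measurable_from_prod_countable_right fun n => (h n).continuous.measurable

theorem kdvNorm_sq {g : ℤ × ℝ → ℂ} (hg : AEStronglyMeasurable g freqMeasure) :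
    kdvNorm g ^ 2 = ∑' n : ℤ, ∫⁻ τ : ℝ, ‖(kdvWeight (n, τ) : ℂ) * g (n, τ)‖ₑ ^ 2 := by
  have h2 := eLpNorm_natCast_pow (μ := freqMeasure) (fun q => (kdvWeight q : ℂ) * g q) 2
  rw [← lintegral_freqMeasure'
    (f := fun q => ‖(kdvWeight q : ℂ) * g q‖ₑ ^ 2)]
  · exact h2
  · exact ((Complex.measurable_ofReal.comp measurable_kdvWeight).aemeasurable.mul
      hg.aemeasurable).enorm.pow_const 2

theorem exists_schwartz_family_approx {g : ℤ × ℝ → ℂ} (hg : AEStronglyMeasurable g freqMeasure)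
    (hfin : kdvNorm g ≠ ∞) {ε : ℝ≥0∞} (hε : ε ≠ 0) :
    ∃ (S : Finset ℤ) (h : ℤ → 𝓢(ℝ, ℂ)), (∀ ξ ∉ S, h ξ = 0) ∧
      kdvNorm (fun q => h q.1 q.2 - g q) ≤ ε := by
  classical
  have hsum : ∑' n : ℤ, ∫⁻ τ : ℝ, ‖(kdvWeight (n, τ) : ℂ) * g (n, τ)‖ₑ ^ 2 ≠ ∞ := by
    rw [← kdvNorm_sq hg]; exact ENNReal.pow_ne_top hfin
  have hε2 : ε ^ 2 / 2 ≠ 0 := by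
    simp [hε]
  obtain ⟨S, hS⟩ := ((ENNReal.tendsto_tsum_compl_atTop_zero hsum).eventually
    (gt_mem_nhds (pos_iff_ne_zero.2 hε2))).exists
  -- Half of `ε ^ 2` pays for the tail outside `S`, half is shared among the slices; the `+ 1`
  -- covers empty `S`.
  have hδ : ε ^ 2 / 2 / (S.card + 1) ≠ 0 := by
    refine ENNReal.div_ne_zero.2 ⟨hε2, by finiteness⟩
  have happ : ∀ n : ℤ, ∃ k : 𝓢(ℝ, ℂ),
      ∫⁻ τ, ‖(kdvWeight (n, τ) : ℂ) * (k τ - g (n, τ))‖ₑ ^ 2 ≤ ε ^ 2 / 2 / (S.card + 1) :=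
    fun n => exists_schwartz_approx n (aestronglyMeasurable_freq_slice hg n)
      (ENNReal.ne_top_of_tsum_ne_top hsum n) hδ
  choose k hk using happ
  obtain ⟨h, hh⟩ : ∃ h : ℤ → 𝓢(ℝ, ℂ), ∀ n, h n = if n ∈ S then k n else 0 := ⟨_, fun _ => rfl⟩
  refine ⟨S, h, fun ξ hξ => (hh ξ).trans (if_neg hξ), ?_⟩
  have hm : AEStronglyMeasurable (fun q : ℤ × ℝ => h q.1 q.2 - g q) freqMeasure :=
    (measurable_schwartz_family h).aestronglyMeasurable.sub hg
  rw [← ENNReal.pow_le_pow_left_iff two_ne_zero, kdvNorm_sq hm, ← ENNReal.sum_add_tsum_compl S]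
  calc _ ≤ ε ^ 2 / 2 + ε ^ 2 / 2 := by
        refine add_le_add ?_ (le_trans (le_of_eq (tsum_congr fun n => ?_)) hS.le)
        · calc _ ≤ ∑ n ∈ S, ε ^ 2 / 2 / (S.card + 1) := by
                refine Finset.sum_le_sum fun n hn => ?_
                have hn' : h n = k n := (hh n).trans (if_pos hn)
                simp only [hn']
                exact hk n
            _ = S.card * (ε ^ 2 / 2 / (S.card + 1)) := by rw [Finset.sum_const, nsmul_eq_mul]
            _ ≤ (S.card + 1) * (ε ^ 2 / 2 / (S.card + 1)) := by gcongr; exact le_self_add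
            _ ≤ _ := ENNReal.mul_div_le
        · refine lintegral_congr fun τ => ?_
          have hn' : h n = 0 := (hh n).trans (if_neg n.2)
          simp [hn']
    _ = _ := ENNReal.add_halves _

/-! ### Functions with a prescribed Fourier transform -/

instance : IsProbabilityMeasure (volume : Measure UnitAddCircle) := by
  rw [UnitAddCircle.volume_eq_haarAddCircle]; infer_instance

instance : ENNReal.HolderTriple 4 (4 / 3) 1 := by
  constructor
  rw [ENNReal.inv_div (by norm_num) (by norm_num), inv_one, ← one_div, ENNReal.div_add_div_same]
  norm_num
  exact ENNReal.div_self (by norm_num) (by norm_num)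

theorem memLp_fourier_mul_schwartz (n : ℤ) (φ : 𝓢(ℝ, ℂ)) (p : ℝ≥0∞) :
    MemLp (fun z : UnitAddCircle × ℝ => fourier n z.1 * φ z.2) p := by
  have h : MemLp (fun z : UnitAddCircle × ℝ => φ z.2) p :=
    (φ.memLp p).comp_measurePreserving measurePreserving_snd
  refine h.of_le ?_ (Filter.Eventually.of_forall fun z => ?_)
  · exact (((fourier n).continuous.comp continuous_fst).mul
      (φ.continuous.comp continuous_snd)).aestronglyMeasurable
  · rw [norm_mul, fourier_apply, Circle.norm_coe, one_mul]

theorem tendsto_integral_mul_of_tendsto_eLpNorm {α : Type*} [MeasurableSpace α] {μ : Measure α}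
    {p q : ℝ≥0∞} [p.HolderTriple q 1] {F : ℕ → α → ℂ} {f ψ : α → ℂ} (hψ : MemLp ψ q μ)
    (hF : ∀ n, AEStronglyMeasurable (F n) μ) (hf : AEStronglyMeasurable f μ)
    (hFψ : ∀ n, Integrable (fun x => F n x * ψ x) μ) (hfψ : Integrable (fun x => f x * ψ x) μ)
    (h : Filter.Tendsto (fun n => eLpNorm (F n - f) p μ) Filter.atTop (nhds 0)) :
    Filter.Tendsto (fun n => ∫ x, F n x * ψ x ∂μ) Filter.atTop (nhds (∫ x, f x * ψ x ∂μ)) := by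
  refine tendsto_integral_of_L1' _ hfψ.1 (Filter.Eventually.of_forall hFψ) ?_
  have h0 : Filter.Tendsto (fun n => eLpNorm (F n - f) p μ * eLpNorm ψ q μ) Filter.atTop
      (nhds 0) := by
    simpa using ENNReal.Tendsto.mul_const h (Or.inr hψ.2.ne)
  refine tendsto_of_tendsto_of_tendsto_of_le_of_le tendsto_const_nhds h0 (fun _ => zero_le)
    fun n => ?_
  refine le_trans (le_of_eq ?_) (eLpNorm_smul_le_mul_eLpNorm (r := 1) hψ.1 ((hF n).sub hf))
  congr 1
  ext x
  simp [sub_mul]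

theorem integral_fourierSum_mul {S : Finset ℤ} {h : ℤ → 𝓢(ℝ, ℂ)} (hS : ∀ ξ ∉ S, h ξ = 0)
    (ξ : ℤ) (φ : 𝓢(ℝ, ℂ)) :
    ∫ p : UnitAddCircle × ℝ, fourierSum S h p * (fourier (-ξ) p.1 * (𝓕 φ) p.2)
      = ∫ τ : ℝ, h ξ τ * φ τ := by
  have e : ∀ p : UnitAddCircle × ℝ, fourierSum S h p * (fourier (-ξ) p.1 * (𝓕 φ) p.2)
      = ∑ n ∈ S, fourier (n - ξ) p.1 * ((𝓕⁻ (h n)) p.2 * (𝓕 φ) p.2) := fun p => by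
    unfold fourierSum
    rw [Finset.sum_mul]
    refine Finset.sum_congr rfl fun n _ => ?_
    rw [sub_eq_add_neg, fourier_add]
    ring
  have hint : ∀ n, Integrable fun p : UnitAddCircle × ℝ =>
      fourier (n - ξ) p.1 * ((𝓕⁻ (h n)) p.2 * (𝓕 φ) p.2) := fun n => by
    have h1 := memLp_fourier_mul_schwartz (n - ξ) (𝓕⁻ (h n)) 2
    have h2 := memLp_fourier_mul_schwartz 0 (𝓕 φ) 2
    refine (h1.integrable_mul h2).congr (Filter.Eventually.of_forall fun p => ?_)
    simp [mul_assoc]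
  simp_rw [e]
  rw [integral_finsetSum _ fun n _ => hint n]
  have e2 : ∀ n, ∫ p : UnitAddCircle × ℝ, fourier (n - ξ) p.1 * ((𝓕⁻ (h n)) p.2 * (𝓕 φ) p.2)
      = if n = ξ then ∫ τ : ℝ, h n τ * φ τ else 0 := fun n => by
    refine (integral_prod_mul (μ := (volume : Measure UnitAddCircle)) (ν := (volume : Measure ℝ))
      (fun x : UnitAddCircle => fourier (n - ξ) x)
      (fun t : ℝ => (𝓕⁻ (h n)) t * (𝓕 φ) t)).trans ?_
    rw [integral_fourier, SchwartzMap.integral_fourierInv_mul_eq,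
      FourierTransform.fourierInv_fourier_eq]
    simp [sub_eq_zero]
  simp_rw [e2]
  rw [Finset.sum_ite_eq' S ξ]
  split_ifs with hξ
  · rfl
  · rw [hS ξ hξ]; simp

theorem fourierSum_sub {S T : Finset ℤ} {h k : ℤ → 𝓢(ℝ, ℂ)} (hS : ∀ ξ ∉ S, h ξ = 0)
    (hT : ∀ ξ ∉ T, k ξ = 0) :
    fourierSum S h - fourierSum T k = fourierSum (S ∪ T) (fun ξ => h ξ - k ξ) := by
  have h0 := map_zero (FourierTransform.fourierInvCLM ℂ 𝓢(ℝ, ℂ))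
  have hs := map_sub (FourierTransform.fourierInvCLM ℂ 𝓢(ℝ, ℂ))
  simp only [FourierTransform.fourierInvCLM_apply] at h0 hs
  ext p
  simp only [Pi.sub_apply, fourierSum, hs, _root_.sub_apply, sub_mul, Finset.sum_sub_distrib]
  congr 1
  · refine Finset.sum_subset Finset.subset_union_left fun ξ _ hξ => ?_
    rw [hS ξ hξ, h0]; simp
  · refine Finset.sum_subset Finset.subset_union_right fun ξ _ hξ => ?_
    rw [hT ξ hξ, h0]; simp

theorem kdvNorm_sub_le {f g k : ℤ × ℝ → ℂ} (hf : AEStronglyMeasurable f freqMeasure)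
    (hg : AEStronglyMeasurable g freqMeasure) (hk : AEStronglyMeasurable k freqMeasure) :
    kdvNorm (fun q => f q - k q) ≤ kdvNorm (fun q => f q - g q) + kdvNorm (fun q => k q - g q) := by
  have hw : AEStronglyMeasurable (fun q => (kdvWeight q : ℂ)) freqMeasure :=
    (Complex.measurable_ofReal.comp measurable_kdvWeight).aestronglyMeasurable
  unfold kdvNorm
  refine le_trans (le_of_eq ?_) (eLpNorm_sub_le (hw.mul (hf.sub hg)) (hw.mul (hk.sub hg))
    (by norm_num))
  congr 1
  ext q
  simp only [Pi.sub_apply]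
  ring

theorem eLpNorm_slice_le_kdvNorm {g : ℤ × ℝ → ℂ} (hg : AEStronglyMeasurable g freqMeasure) (n : ℤ) :
    eLpNorm (fun τ => g (n, τ)) 2 volume ≤ kdvNorm g := by
  rw [← ENNReal.pow_le_pow_left_iff two_ne_zero, kdvNorm_sq hg]
  have h2 := eLpNorm_natCast_pow (μ := volume) (fun τ => g (n, τ)) 2
  refine le_trans ?_ (ENNReal.le_tsum n)
  refine (le_of_eq h2).trans (lintegral_mono fun τ => ?_)
  dsimp only
  gcongr
  rw [enorm_mul]
  refine le_mul_of_one_le_left' ?_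
  rw [← ofReal_norm, Complex.norm_real, Real.norm_of_nonneg (kdvWeight_pos _).le]
  exact ENNReal.one_le_ofReal.2 (one_le_kdvWeight _)

theorem eLpNorm_fourierSum_sub_le {S T : Finset ℤ} {h k : ℤ → 𝓢(ℝ, ℂ)} (hS : ∀ ξ ∉ S, h ξ = 0)
    (hT : ∀ ξ ∉ T, k ξ = 0) {g : ℤ × ℝ → ℂ} (hg : AEStronglyMeasurable g freqMeasure) :
    eLpNorm (fourierSum S h - fourierSum T k) 4 volume ≤
      31 * (kdvNorm (fun q => h q.1 q.2 - g q) + kdvNorm (fun q => k q.1 q.2 - g q)) := by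
  rw [fourierSum_sub hS hT]
  have hsub : ∀ ξ ∉ S ∪ T, h ξ - k ξ = 0 := fun ξ hξ => by
    rw [Finset.mem_union, not_or] at hξ
    rw [hS ξ hξ.1, hT ξ hξ.2, sub_zero]
  refine (eLpNorm_fourierSum_le hsub).trans ?_
  gcongr
  exact kdvNorm_sub_le (measurable_schwartz_family h).aestronglyMeasurable hg
    (measurable_schwartz_family k).aestronglyMeasurable

theorem eLpNorm_fourierSum_le_add {S : Finset ℤ} {h : ℤ → 𝓢(ℝ, ℂ)} (hS : ∀ ξ ∉ S, h ξ = 0)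
    {g : ℤ × ℝ → ℂ} (hg : AEStronglyMeasurable g freqMeasure) :
    eLpNorm (fourierSum S h) 4 volume ≤
      31 * (kdvNorm (fun q => h q.1 q.2 - g q) + kdvNorm g) := by
  refine (eLpNorm_fourierSum_le hS).trans ?_
  gcongr
  have := kdvNorm_sub_le (measurable_schwartz_family h).aestronglyMeasurable hg
    (k := fun _ => 0) aestronglyMeasurable_const
  have e : kdvNorm (fun q => 0 - g q) = kdvNorm g := by
    unfold kdvNorm
    rw [← eLpNorm_neg]
    congr 1; ext q; simp
  rw [e] at this
  simpa only [sub_zero] using this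

/-- Schwartz sums approximating `g` are Cauchy in `L⁴` by the estimate applied to differences. Both
sides of the defining identity pass to the limit by Hölder, with exponents `(4, 4/3)` in space-time
and `(2, 2)` in `τ`. -/
theorem exists_isFourierTransform {g : ℤ × ℝ → ℂ} (hg : AEStronglyMeasurable g freqMeasure)
    (hfin : kdvNorm g ≠ ∞) :
    ∃ U : UnitAddCircle × ℝ → ℂ, IsFourierTransform U g ∧ eLpNorm U 4 volume ≤ 31 * kdvNorm g := by
  have hε : ∀ j : ℕ, (2⁻¹ : ℝ≥0∞) ^ j ≠ 0 := fun j => by simp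
  choose S h hS hh using fun j : ℕ => exists_schwartz_family_approx hg hfin (hε j)
  have hhm : ∀ j, AEStronglyMeasurable (fun q : ℤ × ℝ => h j q.1 q.2) freqMeasure := fun j =>
    (measurable_schwartz_family (h j)).aestronglyMeasurable
  have hz : Filter.Tendsto (fun j : ℕ => (2⁻¹ : ℝ≥0∞) ^ j) Filter.atTop (nhds 0) :=
    ENNReal.tendsto_pow_atTop_nhds_zero_of_lt_one (by norm_num)
  have hUle : ∀ j, eLpNorm (fourierSum (S j) (h j)) 4 volume ≤ 31 * (2⁻¹ ^ j + kdvNorm g) :=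
    fun j => (eLpNorm_fourierSum_le_add (hS j) hg).trans (by gcongr; exact hh j)
  have hUm : ∀ j, MemLp (fourierSum (S j) (h j)) 4 volume := fun j =>
    ⟨(continuous_fourierSum _ _).aestronglyMeasurable, (hUle j).trans_lt (by finiteness)⟩
  -- Differences are at most `31 * 2 = 62` times `2⁻¹ ^ N`; 64 makes the inequality strict, as the
  -- completeness criterion requires.
  have hB : ∑' j : ℕ, (64 : ℝ≥0∞) * 2⁻¹ ^ j ≠ ∞ := by
    rw [ENNReal.tsum_mul_left, ENNReal.tsum_geometric, ENNReal.one_sub_inv_two, inv_inv]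
    finiteness
  have hcau : ∀ N n m : ℕ, N ≤ n → N ≤ m →
      eLpNorm (fourierSum (S n) (h n) - fourierSum (S m) (h m)) 4 volume < 64 * 2⁻¹ ^ N := by
    intro N n m hn hm
    calc _ ≤ _ := eLpNorm_fourierSum_sub_le (hS n) (hS m) hg
      _ ≤ 31 * ((2⁻¹ : ℝ≥0∞) ^ N + 2⁻¹ ^ N) := by
          gcongr
          · exact (hh n).trans (two_inv_pow_le hn)
          · exact (hh m).trans (two_inv_pow_le hm)
      _ = (2⁻¹ : ℝ≥0∞) ^ N * 62 := by ring
      _ < (2⁻¹ : ℝ≥0∞) ^ N * 64 :=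
          ENNReal.mul_lt_mul_right (hε N) (by finiteness) (by norm_num)
      _ = _ := mul_comm _ _
  obtain ⟨U, hU, hlim⟩ := Lp.cauchy_complete_eLpNorm (p := 4) (by norm_num) hUm hB hcau
  have hψ : ∀ (ξ : ℤ) (φ : 𝓢(ℝ, ℂ)), MemLp (fun z : UnitAddCircle × ℝ => fourier ξ z.1 * φ z.2)
      (4 / 3) := fun ξ φ => memLp_fourier_mul_schwartz ξ φ _
  have hslice : ∀ ξ, MemLp (fun τ => g (ξ, τ)) 2 volume := fun ξ =>
    ⟨aestronglyMeasurable_freq_slice hg ξ,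
      (eLpNorm_slice_le_kdvNorm hg ξ).trans_lt hfin.lt_top⟩
  refine ⟨U, ⟨hg, fun φ => ?_, fun ξ φ => (hslice ξ).integrable_mul (φ.memLp 2), fun ξ φ => ?_⟩, ?_⟩
  · refine (hU.integrable_mul (hψ 0 φ)).congr (Filter.Eventually.of_forall fun p => ?_)
    simp
  · have h1 := tendsto_integral_mul_of_tendsto_eLpNorm (p := 4) (hψ (-ξ) (𝓕 φ))
      (fun j => (hUm j).1) hU.1 (fun j => (hUm j).integrable_mul (hψ (-ξ) (𝓕 φ)))
      (hU.integrable_mul (hψ (-ξ) (𝓕 φ))) hlim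
    have h2 := tendsto_integral_mul_of_tendsto_eLpNorm (p := 2) (F := fun j τ => h j ξ τ)
      (φ.memLp 2 volume) (fun j => (h j ξ).continuous.aestronglyMeasurable) (hslice ξ).1
      (fun j => ((h j ξ).memLp 2).integrable_mul (φ.memLp 2))
      ((hslice ξ).integrable_mul (φ.memLp 2))
      (tendsto_of_tendsto_of_tendsto_of_le_of_le tendsto_const_nhds hz (fun _ => zero_le)
        fun j => (eLpNorm_slice_le_kdvNorm ((hhm j).sub hg) ξ).trans (hh j))
    simp_rw [integral_fourierSum_mul (hS _)] at h1
    exact tendsto_nhds_unique h1 h2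
  · have h1 : Filter.Tendsto (fun j : ℕ => eLpNorm (fourierSum (S j) (h j) - U) 4 volume +
        31 * (2⁻¹ ^ j + kdvNorm g)) Filter.atTop (nhds (0 + 31 * (0 + kdvNorm g))) :=
      hlim.add (ENNReal.Tendsto.const_mul (hz.add tendsto_const_nhds) (Or.inr (by norm_num)))
    rw [zero_add, zero_add] at h1
    refine ge_of_tendsto' h1 fun j => ?_
    calc _ = eLpNorm (fourierSum (S j) (h j) - (fourierSum (S j) (h j) - U)) 4 volume := by
          rw [sub_sub_cancel]
      _ ≤ _ := eLpNorm_sub_le (hUm j).1 ((hUm j).1.sub hU.1) (by norm_num)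
      _ ≤ _ := by rw [add_comm]; gcongr; exact hUle j

/-! ### Uniqueness of the function with a given Fourier transform -/

open BoundedContinuousFunction in
-- The densities `f⁺` and `f⁻` define finite measures, and finite measures on a product are
-- determined by products of bounded continuous functions.
theorem ae_eq_zero_of_integral_mul_boundedContinuousFunction {X Y : Type*}
    [TopologicalSpace X] [MeasurableSpace X] [BorelSpace X] [HasOuterApproxClosed X]
    [TopologicalSpace Y] [MeasurableSpace Y] [BorelSpace Y] [HasOuterApproxClosed Y]
    {μ : Measure (X × Y)} {f : X × Y → ℝ} (hf : Integrable f μ)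
    (h : ∀ (P : X →ᵇ ℝ) (Q : Y →ᵇ ℝ), ∫ p, f p * (P p.1 * Q p.2) ∂μ = 0) : f =ᵐ[μ] 0 := by
  have hfm : AEMeasurable (fun p => ENNReal.ofReal (f p)) μ := hf.1.aemeasurable.ennreal_ofReal
  have hgm : AEMeasurable (fun p => ENNReal.ofReal (-f p)) μ := hf.1.aemeasurable.neg.ennreal_ofReal
  have hf1 : ∫⁻ p, ENNReal.ofReal (f p) ∂μ ≠ ∞ := hf.lintegral_lt_top.ne
  have hf2 : ∫⁻ p, ENNReal.ofReal (-f p) ∂μ ≠ ∞ := hf.neg.lintegral_lt_top.ne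
  have i1 : IsFiniteMeasure (μ.withDensity fun p => ENNReal.ofReal (f p)) :=
    isFiniteMeasure_withDensity hf1
  have i2 : IsFiniteMeasure (μ.withDensity fun p => ENNReal.ofReal (-f p)) :=
    isFiniteMeasure_withDensity hf2
  have hb : ∀ g : X × Y → ℝ, Integrable g μ → ∀ (P : X →ᵇ ℝ) (Q : Y →ᵇ ℝ),
      Integrable (fun p => g p • (P p.1 * Q p.2)) μ := fun g hg P Q => by
    refine (hg.bdd_mul (c := ‖P‖ * ‖Q‖) (f := fun p => P p.1 * Q p.2) ?_ ?_).congr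
      (Filter.Eventually.of_forall fun p => mul_comm _ _)
    · exact ((P.continuous.measurable.comp measurable_fst).mul
        (Q.continuous.measurable.comp measurable_snd)).aestronglyMeasurable
    · refine Filter.Eventually.of_forall fun p => ?_
      rw [norm_mul]
      exact mul_le_mul (P.norm_coe_le_norm _) (Q.norm_coe_le_norm _) (norm_nonneg _) (norm_nonneg _)
  have key : (μ.withDensity fun p => ENNReal.ofReal (f p))
      = μ.withDensity fun p => ENNReal.ofReal (-f p) := by
    refine Measure.ext_of_integral_mul_boundedContinuousFunction fun P Q => ?_
    rw [integral_withDensity_eq_integral_toReal_smul₀ hfm (by simp),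
      integral_withDensity_eq_integral_toReal_smul₀ hgm (by simp), ← sub_eq_zero,
      ← integral_sub, ← h P Q]
    · refine integral_congr_ae (Filter.Eventually.of_forall fun p => ?_)
      simp only [smul_eq_mul, ← sub_mul]
      rw [ENNReal.toReal_ofReal', ENNReal.toReal_ofReal']
      congr 1
      rcases le_total 0 (f p) with h0 | h0
      · rw [max_eq_left h0, max_eq_right (by linarith)]; ring
      · rw [max_eq_right h0, max_eq_left (by linarith)]; ring
    · exact hb _ ((hf.real_toNNReal).congr (Filter.Eventually.of_forall fun p => rfl)) P Q
    · exact hb _ ((hf.neg.real_toNNReal).congr (Filter.Eventually.of_forall fun p => rfl)) P Q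
  have := (withDensity_eq_iff hfm hgm hf1).1 key
  filter_upwards [this] with p hp
  rcases le_total 0 (f p) with h0 | h0
  · rw [ENNReal.ofReal_of_nonpos (by linarith : -f p ≤ 0), ENNReal.ofReal_eq_zero] at hp
    exact le_antisymm hp h0
  · rw [ENNReal.ofReal_of_nonpos h0, eq_comm, ENNReal.ofReal_eq_zero] at hp
    exact le_antisymm h0 (neg_nonpos.1 hp)

/-- An integrable function on `𝕋 × ℝ` orthogonal to all `fourier ξ ⊗ ψ` with `ψ` a test function
vanishes almost everywhere. -/
theorem ae_eq_zero_of_integral_fourier_mul_test {f : UnitAddCircle × ℝ → ℂ} (hf : Integrable f)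
    (h : ∀ (ξ : ℤ) (ψ : ℝ → ℝ), ContDiff ℝ ((⊤ : ℕ∞) : WithTop ℕ∞) ψ → HasCompactSupport ψ →
      ∫ p : UnitAddCircle × ℝ, f p * (fourier ξ p.1 * ψ p.2) = 0) : f =ᵐ[volume] 0 := by
  have hint : ∀ (P : C(UnitAddCircle, ℂ)) (Q : ℝ → ℝ) (c : ℝ), Continuous Q → (∀ t, ‖Q t‖ ≤ c) →
      Integrable fun p : UnitAddCircle × ℝ => f p * (P p.1 * Q p.2) := fun P Q c hQ hc => by
    refine (hf.bdd_mul (c := ‖P‖ * c) (f := fun p : UnitAddCircle × ℝ => P p.1 * (Q p.2 : ℂ))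
      ?_ ?_).congr (Filter.Eventually.of_forall fun p => mul_comm _ _)
    · exact ((P.continuous.comp continuous_fst).mul (Complex.continuous_ofReal.comp
        (hQ.comp continuous_snd))).aestronglyMeasurable
    · refine Filter.Eventually.of_forall fun p => ?_
      rw [norm_mul, Complex.norm_real]
      exact mul_le_mul (P.norm_coe_le_norm _) (hc _) (norm_nonneg _) (norm_nonneg _)
  have hbd : ∀ ψ : ℝ → ℝ, Continuous ψ → HasCompactSupport ψ → ∃ c, ∀ t, ‖ψ t‖ ≤ c :=
    fun ψ h1 h2 => h2.exists_bound_of_continuous h1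
  -- continuous functions of `x`
  have h1 : ∀ (P : C(UnitAddCircle, ℂ)) (ψ : ℝ → ℝ), ContDiff ℝ ((⊤ : ℕ∞) : WithTop ℕ∞) ψ →
      HasCompactSupport ψ → ∫ p : UnitAddCircle × ℝ, f p * (P p.1 * ψ p.2) = 0 := by
    intro P ψ hψ1 hψ2
    obtain ⟨c, hc⟩ := hbd ψ hψ1.continuous hψ2
    let Λ : C(UnitAddCircle, ℂ) →ₗ[ℂ] ℂ :=
      { toFun := fun P => ∫ p : UnitAddCircle × ℝ, f p * (P p.1 * ψ p.2)
        map_add' := fun P P' => by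
          rw [← integral_add (hint P ψ c hψ1.continuous hc) (hint P' ψ c hψ1.continuous hc)]
          refine integral_congr_ae (Filter.Eventually.of_forall fun p => ?_)
          simp only [ContinuousMap.add_apply]
          ring
        map_smul' := fun a P => by
          rw [RingHom.id_apply, smul_eq_mul, ← integral_const_mul]
          refine integral_congr_ae (Filter.Eventually.of_forall fun p => ?_)
          simp only [ContinuousMap.smul_apply, smul_eq_mul]
          ring }
    let Λ' : C(UnitAddCircle, ℂ) →L[ℂ] ℂ :=
      Λ.mkContinuous (∫ p : UnitAddCircle × ℝ, ‖f p‖ * c) fun P => by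
        refine (norm_integral_le_integral_norm _).trans ?_
        rw [← integral_mul_const]
        refine integral_mono_of_nonneg (Filter.Eventually.of_forall fun p => norm_nonneg _)
          ((hf.norm.mul_const c).mul_const _) (Filter.Eventually.of_forall fun p => ?_)
        dsimp only
        rw [norm_mul, norm_mul, Complex.norm_real, mul_assoc, mul_comm c]
        gcongr
        · exact P.norm_coe_le_norm _
        · exact hc _
    -- A continuous functional vanishing on the characters is zero, since their span is dense.
    have hΛ : Λ' = 0 := by
      refine ContinuousLinearMap.ext_on (s := Set.range (fourier (T := 1))) ?_ ?_
      · rw [Submodule.dense_iff_topologicalClosure_eq_top]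
        exact span_fourier_closure_eq_top
      · rintro _ ⟨ξ, rfl⟩
        exact h ξ ψ hψ1 hψ2
    exact congrArg (fun L : C(UnitAddCircle, ℂ) →L[ℂ] ℂ => L P) hΛ
  -- bounded continuous functions of `t`
  have h2 : ∀ (P : C(UnitAddCircle, ℂ)) (Q : BoundedContinuousFunction ℝ ℝ),
      ∫ p : UnitAddCircle × ℝ, f p * (P p.1 * Q p.2) = 0 := by
    intro P Q
    have hP : Integrable fun p : UnitAddCircle × ℝ => f p * P p.1 := by
      simpa using hint P (fun _ => 1) 1 continuous_const (by simp)
    have hH : Integrable fun t : ℝ => ∫ x : UnitAddCircle, f (x, t) * P x := hP.integral_prod_right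
    have hswap : ∀ (ψ : ℝ → ℝ) (c : ℝ), Continuous ψ → (∀ t, ‖ψ t‖ ≤ c) →
        ∫ p : UnitAddCircle × ℝ, f p * (P p.1 * ψ p.2)
          = ∫ t : ℝ, ψ t • ∫ x : UnitAddCircle, f (x, t) * P x := fun ψ c hψ hc => by
      have := hint P ψ c hψ hc
      rw [Measure.volume_eq_prod] at this ⊢
      rw [integral_prod_symm _ this]
      refine integral_congr_ae (Filter.Eventually.of_forall fun t => ?_)
      dsimp only
      rw [Complex.real_smul, ← integral_const_mul]
      refine integral_congr_ae (Filter.Eventually.of_forall fun x => ?_)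
      dsimp only
      ring
    -- For fixed `P`, the partial integral in `x` is orthogonal to all test functions of `t`, so it
    -- vanishes almost everywhere and may be paired with any bounded `Q`.
    have hzero := ae_eq_zero_of_integral_contDiff_smul_eq_zero hH.locallyIntegrable
      fun ψ hψ1 hψ2 => by
        obtain ⟨c, hc⟩ := hbd ψ hψ1.continuous hψ2
        rw [← hswap ψ c hψ1.continuous hc, h1 P ψ hψ1 hψ2]
    rw [hswap Q ‖Q‖ Q.continuous Q.norm_coe_le_norm]
    refine (integral_congr_ae ?_).trans (integral_zero _ _)
    filter_upwards [hzero] with t ht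
    rw [ht, smul_zero]
  have h3 : ∀ (P : BoundedContinuousFunction UnitAddCircle ℝ) (Q : BoundedContinuousFunction ℝ ℝ),
      Integrable (fun p : UnitAddCircle × ℝ => f p * ((P p.1 * Q p.2 : ℝ) : ℂ)) ∧
      ∫ p : UnitAddCircle × ℝ, f p * ((P p.1 * Q p.2 : ℝ) : ℂ) = 0 := fun P Q => by
    let P' : C(UnitAddCircle, ℂ) := ⟨fun x => (P x : ℂ), Complex.continuous_ofReal.comp P.continuous⟩
    push_cast
    exact ⟨hint P' Q ‖Q‖ Q.continuous Q.norm_coe_le_norm, h2 P' Q⟩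
  have hre := ae_eq_zero_of_integral_mul_boundedContinuousFunction hf.re fun P Q => by
    have h4 := integral_re (h3 P Q).1
    rw [(h3 P Q).2, map_zero] at h4
    rw [← h4]
    refine integral_congr_ae (Filter.Eventually.of_forall fun p => ?_)
    simp only [RCLike.re_to_complex, Complex.re_mul_ofReal]
  have him := ae_eq_zero_of_integral_mul_boundedContinuousFunction hf.im fun P Q => by
    have h4 := integral_im (h3 P Q).1
    rw [(h3 P Q).2, map_zero] at h4
    rw [← h4]
    refine integral_congr_ae (Filter.Eventually.of_forall fun p => ?_)
    simp only [RCLike.im_to_complex, Complex.im_mul_ofReal]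
  filter_upwards [hre, him] with p hp1 hp2
  exact Complex.ext hp1 hp2

/-- Multiplying `u - v` by a Schwartz function of `t` makes it integrable, and the Schwartz factor
absorbs any test function, so orthogonality to characters times test functions applies. Cutoffs
equal to 1 on `|t| ≤ n` then exhaust the line. -/
theorem IsFourierTransform.ae_eq {u v : UnitAddCircle × ℝ → ℂ} {g : ℤ × ℝ → ℂ}
    (hu : IsFourierTransform u g) (hv : IsFourierTransform v g) : u =ᵐ[volume] v := by
  have hint : ∀ w : UnitAddCircle × ℝ → ℂ, IsFourierTransform w g → ∀ (ξ : ℤ) (φ : 𝓢(ℝ, ℂ)),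
      Integrable fun p : UnitAddCircle × ℝ => w p * (fourier ξ p.1 * φ p.2) := fun w hw ξ φ => by
    refine ((hw.integrable_left φ).bdd_mul (c := 1) (f := fun p : UnitAddCircle × ℝ => fourier ξ p.1)
      ((fourier ξ).continuous.comp continuous_fst).aestronglyMeasurable
      (Filter.Eventually.of_forall fun p => ?_)).congr (Filter.Eventually.of_forall fun p => ?_)
    · rw [fourier_apply, Circle.norm_coe]
    · dsimp only; ring
  have horth : ∀ (ξ : ℤ) (φ : 𝓢(ℝ, ℂ)),
      ∫ p : UnitAddCircle × ℝ, (u p - v p) * (fourier ξ p.1 * φ p.2) = 0 := fun ξ φ => by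
    simp_rw [sub_mul]
    rw [integral_sub (hint u hu ξ φ) (hint v hv ξ φ), sub_eq_zero]
    have h1 := hu.integral_eq (-ξ) (𝓕⁻ φ)
    have h2 := hv.integral_eq (-ξ) (𝓕⁻ φ)
    rw [neg_neg, FourierTransform.fourier_fourierInv_eq] at h1 h2
    rw [h1, h2]
  have hcut : ∀ φ : 𝓢(ℝ, ℂ), (fun p : UnitAddCircle × ℝ => (u p - v p) * φ p.2) =ᵐ[volume] 0 :=
    fun φ => by
    have hi : Integrable fun p : UnitAddCircle × ℝ => (u p - v p) * φ p.2 := by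
      simp_rw [sub_mul]
      exact (hu.integrable_left φ).sub (hv.integrable_left φ)
    refine ae_eq_zero_of_integral_fourier_mul_test hi fun ξ ψ hψ1 hψ2 => ?_
    have hk1 : HasCompactSupport fun t => (ψ t : ℂ) * φ t :=
      (hψ2.comp_left (g := Complex.ofReal) Complex.ofReal_zero).mul_right
    have hk2 : ContDiff ℝ ((⊤ : ℕ∞) : WithTop ℕ∞) fun t => (ψ t : ℂ) * φ t :=
      (Complex.ofRealCLM.contDiff.comp hψ1).mul φ.smooth'
    rw [← horth ξ (hk1.toSchwartzMap hk2)]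
    refine integral_congr_ae (Filter.Eventually.of_forall fun p => ?_)
    dsimp only
    rw [HasCompactSupport.toSchwartzMap_toFun]
    ring
  have hbump : ∀ n : ℕ, ∃ φ : 𝓢(ℝ, ℂ), ∀ t : ℝ, |t| ≤ n → φ t = 1 := fun n => by
    let b : ContDiffBump (0 : ℝ) := ⟨n + 1, n + 2, by positivity, by linarith⟩
    have hk1 : HasCompactSupport fun t => ((b t : ℝ) : ℂ) :=
      b.hasCompactSupport.comp_left (g := Complex.ofReal) Complex.ofReal_zero
    have hk2 : ContDiff ℝ ((⊤ : ℕ∞) : WithTop ℕ∞) fun t => ((b t : ℝ) : ℂ) :=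
      Complex.ofRealCLM.contDiff.comp b.contDiff
    refine ⟨hk1.toSchwartzMap hk2, fun t ht => ?_⟩
    rw [HasCompactSupport.toSchwartzMap_toFun, b.one_of_mem_closedBall, Complex.ofReal_one]
    rw [Metric.mem_closedBall, Real.dist_eq, sub_zero]
    exact ht.trans (by simp [b])
  choose φ hφ using hbump
  filter_upwards [ae_all_iff.2 fun n => hcut (φ n)] with p hp
  obtain ⟨n, hn⟩ := exists_nat_ge |p.2|
  have := hp n
  rw [hφ n _ hn, mul_one] at this
  exact sub_eq_zero.1 this

theorem eLpNorm_four_le_kdvNorm {u : UnitAddCircle × ℝ → ℂ} {g : ℤ × ℝ → ℂ}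
    (h : IsFourierTransform u g) : eLpNorm u 4 volume ≤ 31 * kdvNorm g := by
  rcases eq_or_ne (kdvNorm g) ∞ with hg | hg
  · simp [hg]
  · obtain ⟨U, hU, hle⟩ := exists_isFourierTransform h.aestronglyMeasurable hg
    rwa [eLpNorm_congr_ae (h.ae_eq hU)]

theorem mainTheorem9 :
    ∃ C : ℝ≥0, ∀ u : UnitAddCircle × ℝ → ℂ,
      eLpNorm u 4 volume ≤ C * xsbNorm 0 (1 / 3) (fun ξ : ℤ => (ξ : ℝ) ^ 3) u := by
  refine ⟨31, fun u => ?_⟩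
  unfold xsbNorm
  -- A nonzero finite constant passes inside the infimum, so it suffices to treat each transform;
  -- with none, the right side is `∞`.
  rw [ENNReal.mul_iInf_of_ne (by norm_num) (by norm_num)]
  refine le_iInf fun g => ?_
  rw [ENNReal.mul_iInf_of_ne (by norm_num) (by norm_num)]
  refine le_iInf fun h => ?_
  refine (eLpNorm_four_le_kdvNorm h).trans (le_of_eq ?_)
  simp [kdvNorm, kdvWeight]
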